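/- Let $(X,d)$ be a geodesic metric space with a base point $o\in X$, and let $G$ be a group acting on $X$ by isometries. Suppose that: * the action is (metrically) proper: for all $x\in X$ and $r\ge 0$ the set $\{g\in G : d(x,g.o)\le r\}$ is finite; * $G$ contains a strongly contracting element, i.e. an element $c$ of infinite order such that $Y=\langle c\rangle.o$ is strongly contracting: there is $C\ge 0$ such that for all $x,x'\in X$ with $d(x,x')\le d(x,Y)$ the set $\pi_Y(x)\cup\pi_Y(x')$ has diameter at most $C$, where $\pi_Y(x)=\{y\in Y : d(x,y)=d(x,Y)\}$; * $G$ has purely exponential growth: there are $\delta>0$, $\Delta>0$ and $C>0$ such that for all $r\ge 0$ $$\tfrac1C\,e^{\delta r}\ \le\ \#\{y\in G.o : r\le d(o,y)<r+\Delta\}\ \le\ C\,e^{\delta r}.$$ For a subgroup $H$ of $G$ let $$\delta_H=\limsup_{r\to\infty}\frac{\log\#\{y\in H.o : d(o,y)\le r\}}{r}$$ be its exponential growth rate. Then every infinite normal subgroup $N$ of $G$ satisfies $\delta_N/\delta_G>\tfrac12$. -/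

import Mathlib

open Filter

namespace Cogrowth

/-- A metric space is geodesic if any two points are joined by an isometrically embedded
interval whose length is their distance. -/
def IsGeodesicSpace (X : Type*) [MetricSpace X] : Prop :=
  ∀ x y : X, ∃ γ : ℝ → X, γ 0 = x ∧ γ (dist x y) = y ∧
    ∀ s ∈ Set.Icc (0 : ℝ) (dist x y), ∀ t ∈ Set.Icc (0 : ℝ) (dist x y),
      dist (γ s) (γ t) = |s - t|

/-- The action of `G` on `X` is (metrically) proper, with respect to the base point `o`. -/
def IsProperAction (G : Type*) {X : Type*} [Group G] [MetricSpace X] [MulAction G X]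
    (o : X) : Prop :=
  ∀ (x : X) (r : ℝ), {g : G | dist x (g • o) ≤ r}.Finite

/-- Closest point projection of `x` to `Y`, as a set. -/
def proj {X : Type*} [MetricSpace X] (Y : Set X) (x : X) : Set X :=
  {y ∈ Y | dist x y = Metric.infDist x Y}

/-- `Y` is `C`-strongly contracting: whenever `dist x x' ≤ dist x Y`, the set
`proj Y x ∪ proj Y x'` has diameter at most `C`. -/
def IsStronglyContractingWith {X : Type*} [MetricSpace X] (C : ℝ) (Y : Set X) : Prop :=
  ∀ x x' : X, dist x x' ≤ Metric.infDist x Y →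
    ∀ p ∈ proj Y x ∪ proj Y x', ∀ q ∈ proj Y x ∪ proj Y x', dist p q ≤ C

/-- `Y` is strongly contracting. -/
def IsStronglyContracting {X : Type*} [MetricSpace X] (Y : Set X) : Prop :=
  ∃ C : ℝ, 0 ≤ C ∧ IsStronglyContractingWith C Y

/-- `c` is a strongly contracting element: it has infinite order and the orbit of `o` under the
cyclic group it generates is a strongly contracting set. -/
def IsStronglyContractingElement {G X : Type*} [Group G] [MetricSpace X] [MulAction G X]
    (o : X) (c : G) : Prop :=
  ¬ IsOfFinOrder c ∧ IsStronglyContracting (MulAction.orbit (Subgroup.zpowers c) o)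

/-- The spherical shell of points `x` with `r ≤ dist x o < r + Δ`. -/
def shell {X : Type*} [MetricSpace X] (o : X) (r Δ : ℝ) : Set X :=
  Metric.ball o (r + Δ) \ Metric.ball o r

/-- `Y` has purely exponential growth: for some `δ, Δ > 0`, the number of points of `Y` in the
shell of inner radius `r` and width `Δ` is, up to a multiplicative constant independent of
`r ≥ 0`, equal to `exp (δ r)`. (The lower bound forces these sets of points to be finite.) -/
def HasPurelyExponentialGrowth {X : Type*} [MetricSpace X] (o : X) (Y : Set X) : Prop :=
  ∃ δ : ℝ, 0 < δ ∧ ∃ Δ : ℝ, 0 < Δ ∧ ∃ C : ℝ, 0 < C ∧ ∀ r : ℝ, 0 ≤ r →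
    Real.exp (δ * r) / C ≤ ((Y ∩ shell o r Δ).ncard : ℝ) ∧
      ((Y ∩ shell o r Δ).ncard : ℝ) ≤ C * Real.exp (δ * r)

/-- The exponential growth rate of `Y`, i.e. the limsup as `r → ∞` of
`log #(Y ∩ closedBall o r) / r`, for a set `Y` having finitely many points in each ball.
The limsup is taken in the extended reals, so that it always exists. -/
noncomputable def growthRate {X : Type*} [MetricSpace X] (o : X) (Y : Set X) : EReal :=
  limsup (fun r : ℝ =>
    ((Real.log ((Y ∩ Metric.closedBall o r).ncard : ℝ) / r : ℝ) : EReal)) atTop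

end Cogrowth

open Filter

namespace Cogrowth

/-! ### Geodesics and strongly contracting sets -/

section Contraction

variable {X : Type*} [MetricSpace X]

/-! Let Y be the orbit of `o` under the powers of `c`, let E be the commensurator of these powers in
G (`elementaryClosure`), and write |g| for `len o g`. Pick n in N outside E and put u = c^m n c^(-m)
with m large. For g in G the word w_g = g u g⁻¹ u lies in N and |w_g| ≤ 2(|g| + |u|). Suppose that
for g in a finite set A these words play ping-pong with disjoint images and that ∑_{g ∈ A}
exp(-δ(|g| + |u|)) > 1. By continuity ∑ exp(-s |w_g|) > 1 for some s > δ/2. Its k-th powers are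
bounded by sums of exp(-s d(o,p)) over distinct points p of the N-orbit (`exists_pow_le_sum_exp`),
so the Poincaré series of N diverges at s, and δ_N > δ/2 ≥ δ_G/2.

Ping-pong takes place on the points whose projection to Y is close to `o`. Translates of Y by
elements outside E have bounded projection to Y (`exists_bounded_projection`), which gives a
Behrstock-type inequality (`transverse`). Words with g, g' of almost equal length have disjoint
images when g and g' lie in distinct cosets of E. If g' is much longer than g, a collision forces g'
into the shadow of g u g⁻¹ (`conjWord_smul_ne_of_not_inShadow`).

Purely exponential growth makes A large. Suitable g have positive proportion in every large shell
(`exists_admissible_density`), so each shell adds a definite amount to the sum. A shell of radius r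
casts at most about exp(δr) shadows, but their apices g u g⁻¹ are at distance about 2r, so together
they cover only a proportion of order exp(-δr) of a later shell. Discarding shadows is thus cheap
when radii are large, and enough sparse shells push the sum above 1 (`exists_free_words`). -/

/-- Along a geodesic which stays at distance at least `D ≥ 2 * C` from a `C`-contracting set
until its endpoint, which is at distance at most `D`, the projection moves by at most `6 * C`. -/
theorem dist_proj_le_of_le_infDist {Y : Set X} {C : ℝ} (hC : 0 < C)
    (hY : IsStronglyContractingWith C Y) (hne : ∀ x, (proj Y x).Nonempty)
    {γ : ℝ → X} {l : ℝ} (hl : 0 ≤ l)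
    (hγ : ∀ s ∈ Set.Icc 0 l, ∀ t ∈ Set.Icc 0 l, dist (γ s) (γ t) = |s - t|)
    {D : ℝ} (hD : 2 * C ≤ D) (hend : Metric.infDist (γ l) Y ≤ D)
    (hfar : ∀ t ∈ Set.Ico 0 l, D ≤ Metric.infDist (γ t) Y)
    {y y' : X} (hy : y ∈ proj Y (γ 0)) (hy' : y' ∈ proj Y (γ l)) :
    dist y y' ≤ 6 * C := by
  set d0 := Metric.infDist (γ 0) Y with hd0
  have h0 : (0 : ℝ) ∈ Set.Icc 0 l := ⟨le_rfl, hl⟩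
  have h1 : l ∈ Set.Icc 0 l := ⟨hl, le_rfl⟩
  have hd0n : 0 ≤ d0 := Metric.infDist_nonneg
  rcases le_or_gt l d0 with hc | hc
  · have := hY (γ 0) (γ l) (by rw [hγ 0 h0 l h1, zero_sub, abs_neg, abs_of_nonneg hl]; exact hc)
      y (Or.inl hy) y' (Or.inr hy')
    linarith
  -- Jump repeatedly from time t to t + d(γ t, Y): each jump moves the projection by at most C and
  -- advances by at least D, until the endpoint is within reach.
  have key : ∀ k : ℕ, dist y y' ≤ 6 * C ∨ ∃ t ∈ Set.Icc 0 l, ∃ z ∈ proj Y (γ t),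
      dist y z ≤ (k + 1) * C ∧ d0 + k * D ≤ t := by
    intro k
    induction k with
    | zero =>
      right
      have ht : d0 ∈ Set.Icc 0 l := ⟨hd0n, hc.le⟩
      obtain ⟨z, hz⟩ := hne (γ d0)
      refine ⟨d0, ht, z, hz, ?_, by simp⟩
      have := hY (γ 0) (γ d0) (by rw [hγ 0 h0 d0 ht, zero_sub, abs_neg, abs_of_nonneg hd0n])
        y (Or.inl hy) z (Or.inr hz)
      simpa using this
    | succ k ih =>
      rcases ih with ih | ⟨t, ht, z, hz, hyz, htk⟩
      · exact Or.inl ih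
      rcases le_or_gt l (t + Metric.infDist (γ t) Y) with hc' | hc'
      · left
        have h2 := hY (γ t) (γ l) (by
          rw [hγ t ht l h1, abs_sub_comm, abs_of_nonneg (by linarith [ht.2])]; linarith)
          z (Or.inl hz) y' (Or.inr hy')
        have h3 : dist y y' ≤ (k + 2) * C := by linarith [dist_triangle y z y']
        have h4 : l ≤ d0 + dist y y' + D := by
          have e1 : dist (γ 0) (γ l) = l := by
            rw [hγ 0 h0 l h1, zero_sub, abs_neg, abs_of_nonneg hl]
          have e2 := dist_triangle4 (γ 0) y y' (γ l)
          have e3 := hy.2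
          have e4 := hy'.2
          rw [dist_comm] at e4
          linarith
        have h5 : (k : ℝ) * D ≤ (k + 2) * C + D := by linarith [ht.2]
        -- With D ≥ 2C, `h5` gives 2(k - 1) ≤ k + 2, so at most six moves of size C occur in total.
        have h6 : k ≤ 4 := by
          by_contra h
          have : (5 : ℝ) ≤ k := by exact_mod_cast (by omega : 5 ≤ k)
          nlinarith
        have h7 : (k : ℝ) ≤ 4 := by exact_mod_cast h6
        nlinarith
      · right
        have hφ : 0 ≤ Metric.infDist (γ t) Y := Metric.infDist_nonneg
        have hDt : D ≤ Metric.infDist (γ t) Y := by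
          refine hfar t ⟨ht.1, ?_⟩
          linarith
        have ht' : t + Metric.infDist (γ t) Y ∈ Set.Icc 0 l := ⟨by linarith [ht.1], hc'.le⟩
        obtain ⟨z', hz'⟩ := hne (γ (t + Metric.infDist (γ t) Y))
        refine ⟨_, ht', z', hz', ?_, ?_⟩
        · have := hY (γ t) (γ (t + Metric.infDist (γ t) Y)) (by
            rw [hγ t ht _ ht', abs_sub_comm, add_sub_cancel_left, abs_of_nonneg hφ])
            z (Or.inl hz) z' (Or.inr hz')
          push_cast
          linarith [dist_triangle y z z']
        · push_cast
          linarith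
  obtain ⟨k, hk⟩ := exists_nat_gt (l / D)
  rw [div_lt_iff₀ (by linarith)] at hk
  rcases key k with h | ⟨t, ht, -, -, -, h⟩
  · exact h
  · linarith [ht.2]

/-- If two points have far apart projections to a contracting set, then the distance between
them is, up to an additive constant, the length of the path through the projections. -/
theorem dist_add_dist_add_dist_le {Y : Set X} {C : ℝ} (hC : 0 < C) (hgeo : IsGeodesicSpace X)
    (hY : IsStronglyContractingWith C Y) (hne : ∀ x, (proj Y x).Nonempty)
    {x x' y y' : X} (hy : y ∈ proj Y x) (hy' : y' ∈ proj Y x') (hfar : 32 * C < dist y y') :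
    dist x y + dist y y' + dist y' x' ≤ dist x x' + 32 * C := by
  obtain ⟨γ, hx, hx', hγ⟩ := hgeo x x'
  set L := dist x x' with hL
  have hL0 : 0 ≤ L := dist_nonneg
  have h0 : (0 : ℝ) ∈ Set.Icc 0 L := ⟨le_rfl, hL0⟩
  have h1 : L ∈ Set.Icc 0 L := ⟨hL0, le_rfl⟩
  have hcont : ContinuousOn (fun t => Metric.infDist (γ t) Y) (Set.Icc 0 L) := by
    refine (Metric.continuous_infDist_pt Y).comp_continuousOn ?_
    rw [Metric.continuousOn_iff]
    intro b hb ε hε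
    refine ⟨ε, hε, fun a ha hab => ?_⟩
    rw [hγ a ha b hb]
    simpa [Real.dist_eq] using hab
  have fwd : ∀ t ∈ Set.Icc 0 L, ∀ D, 2 * C ≤ D → Metric.infDist (γ t) Y ≤ D →
      (∀ s ∈ Set.Ico 0 t, D ≤ Metric.infDist (γ s) Y) → ∀ z ∈ proj Y (γ t),
      dist y z ≤ 6 * C := by
    intro t ht D hD hend hs z hz
    exact dist_proj_le_of_le_infDist (γ := γ) hC hY hne ht.1
      (fun a ha b hb => hγ a ⟨ha.1, ha.2.trans ht.2⟩ b ⟨hb.1, hb.2.trans ht.2⟩) hD hend hs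
      (by rw [hx]; exact hy) hz
  have bwd : ∀ t ∈ Set.Icc 0 L, ∀ D, 2 * C ≤ D → Metric.infDist (γ t) Y ≤ D →
      (∀ s ∈ Set.Ioc t L, D ≤ Metric.infDist (γ s) Y) → ∀ z ∈ proj Y (γ t),
      dist y' z ≤ 6 * C := by
    intro t ht D hD hend hs z hz
    refine dist_proj_le_of_le_infDist (γ := fun s => γ (L - s)) (l := L - t) hC hY hne
      (by linarith [ht.2]) (fun a ha b hb => ?_) hD (by simpa using hend) (fun s hs' => ?_)
      (by simpa [hx'] using hy') (by simpa using hz)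
    · rw [hγ (L - a) ⟨by linarith [ha.2, ht.1], by linarith [ha.1]⟩ (L - b)
        ⟨by linarith [hb.2, ht.1], by linarith [hb.1]⟩, abs_sub_comm]
      congr 1
      ring
    · exact hs (L - s) ⟨by linarith [hs'.2], by linarith [hs'.1]⟩
  -- Otherwise cut the geodesic at a point closest to Y: both halves satisfy the previous lemma with
  -- D the minimal distance, so y and y' are within 12C.
  have hnear : ∃ t ∈ Set.Icc 0 L, Metric.infDist (γ t) Y ≤ 2 * C := by
    by_contra! h
    obtain ⟨t, ht, hmin⟩ := isCompact_Icc.exists_isMinOn ⟨0, h0⟩ hcont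
    obtain ⟨z, hz⟩ := hne (γ t)
    have e1 := fwd t ht _ (h t ht).le le_rfl
      (fun s hs => hmin ⟨hs.1, hs.2.le.trans ht.2⟩) z hz
    have e2 := bwd t ht _ (h t ht).le le_rfl
      (fun s hs => hmin ⟨ht.1.trans hs.1.le, hs.2⟩) z hz
    linarith [dist_triangle_right y y' z]
  set S := {t ∈ Set.Icc 0 L | Metric.infDist (γ t) Y ≤ 2 * C} with hS
  have hSc : IsCompact S := by
    refine isCompact_Icc.of_isClosed_subset ?_ (Set.sep_subset _ _)
    exact hcont.preimage_isClosed_of_isClosed isClosed_Icc isClosed_Iic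
  have hSne : S.Nonempty := hnear
  obtain ⟨s, hs, hsl⟩ := hSc.exists_isLeast hSne
  obtain ⟨t, ht, htg⟩ := hSc.exists_isGreatest hSne
  have hst : s ≤ t := hsl ht
  obtain ⟨p, hp⟩ := hne (γ s)
  obtain ⟨q, hq⟩ := hne (γ t)
  have e1 := fwd s hs.1 (2 * C) le_rfl hs.2 (fun a ha => by
    by_contra! h
    have := hsl (show a ∈ S from ⟨⟨ha.1, ha.2.le.trans hs.1.2⟩, h.le⟩)
    linarith [ha.2]) p hp
  have e2 := bwd t ht.1 (2 * C) le_rfl ht.2 (fun a ha => by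
    by_contra! h
    have := htg (show a ∈ S from ⟨⟨ht.1.1.trans ha.1.le, ha.2⟩, h.le⟩)
    linarith [ha.1]) q hq
  -- At the first and last times within 2C of Y the geodesic is 2C + 6C close to y and y'. Each
  -- detour of 8C is paid twice, whence 32C.
  have f1 : dist (γ s) y ≤ 8 * C := by
    have := hp.2
    linarith [dist_triangle_right (γ s) y p, hs.2]
  have f2 : dist (γ t) y' ≤ 8 * C := by
    have := hq.2
    linarith [dist_triangle_right (γ t) y' q, ht.2]
  have g1 : dist x (γ s) = s := by
    rw [← hx, hγ 0 h0 s hs.1, zero_sub, abs_neg, abs_of_nonneg hs.1.1]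
  have g2 : dist (γ t) x' = L - t := by
    conv_lhs => rw [← hx']
    rw [hγ t ht.1 L h1, abs_sub_comm, abs_of_nonneg (by linarith [ht.1.2])]
  have g3 : dist (γ s) (γ t) = t - s := by
    rw [hγ s hs.1 t ht.1, abs_sub_comm, abs_of_nonneg (by linarith)]
  have k1 := dist_triangle x (γ s) y
  have k2 := dist_triangle4_left (γ s) y' y (γ t)
  have k3 := dist_triangle_left y' x' (γ t)
  have k4 := dist_triangle4 y (γ s) (γ t) y'
  rw [dist_comm y (γ s)] at k4
  linarith

end Contraction

end Cogrowth

/-! ### Orbit lengths, the commensurator of `c`, and axis projections -/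

namespace Cogrowth

section Length

variable {G X : Type*} [Group G] [MetricSpace X] [MulAction G X]

/-- The length of a group element: the distance by which it moves the base point. -/
def len (o : X) (g : G) : ℝ := dist o (g • o)

theorem len_nonneg (o : X) (g : G) : 0 ≤ len o g := dist_nonneg

theorem len_one (o : X) : len o (1 : G) = 0 := by simp [len]

variable [IsIsometricSMul G X]

theorem dist_smul_smul_eq_len (o : X) (g h : G) : dist (g • o) (h • o) = len o (g⁻¹ * h) := by
  rw [len, ← dist_smul g o, smul_smul, mul_inv_cancel_left]

theorem len_inv (o : X) (g : G) : len o g⁻¹ = len o g := by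
  rw [len, len, ← dist_smul g o, smul_inv_smul, dist_comm]

theorem len_mul_le (o : X) (g h : G) : len o (g * h) ≤ len o g + len o h := by
  have := dist_triangle o (g • o) ((g * h) • o)
  rw [dist_smul_smul_eq_len, inv_mul_cancel_left] at this
  exact this

theorem dist_inv_smul (g : G) (x y : X) : dist (g⁻¹ • x) y = dist x (g • y) := by
  rw [← dist_smul g, smul_inv_smul]

theorem len_zpow_neg (o : X) (c : G) (i : ℤ) : len o (c ^ (-i)) = len o (c ^ i) := by
  rw [zpow_neg, len_inv]

theorem dist_zpow_zpow (o : X) (c : G) (i j : ℤ) :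
    dist (c ^ i • o) (c ^ j • o) = len o (c ^ (j - i)) := by
  rw [dist_smul_smul_eq_len, ← zpow_neg, ← zpow_add, neg_add_eq_sub]

end Length

/-- The subgroup of elements `g` conjugating a nontrivial power of `c` to a power of `c`. -/
def elementaryClosure {G : Type*} [Group G] (c : G) : Subgroup G where
  carrier := {g | ∃ p q : ℤ, p ≠ 0 ∧ q ≠ 0 ∧ g * c ^ p * g⁻¹ = c ^ q}
  one_mem' := ⟨1, 1, one_ne_zero, one_ne_zero, by simp⟩
  mul_mem' := by
    rintro a b ⟨p, q, hp, hq, h⟩ ⟨p', q', hp', hq', h'⟩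
    refine ⟨p' * p, q * q', mul_ne_zero hp' hp, mul_ne_zero hq hq', ?_⟩
    have e1 : b * c ^ (p' * p) * b⁻¹ = c ^ (p * q') := by
      rw [zpow_mul, ← conj_zpow, h', ← zpow_mul, mul_comm]
    calc a * b * c ^ (p' * p) * (a * b)⁻¹ = a * (b * c ^ (p' * p) * b⁻¹) * a⁻¹ := by group
      _ = c ^ (q * q') := by rw [e1, zpow_mul, ← conj_zpow, h, ← zpow_mul]
  inv_mem' := by
    rintro a ⟨p, q, hp, hq, h⟩
    exact ⟨q, p, hq, hp, by rw [← h]; group⟩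

theorem zpow_mem_elementaryClosure {G : Type*} [Group G] (c : G) (i : ℤ) :
    c ^ i ∈ elementaryClosure c :=
  ⟨1, 1, one_ne_zero, one_ne_zero, by group⟩

/-- `τ` is a closest point projection to the orbit of `o` under the powers of `c`, with the
coarse properties, up to the constant `κ`, of projections to strongly contracting sets. -/
structure AxisProjection {G X : Type*} [Group G] [MetricSpace X] [MulAction G X]
    (o : X) (c : G) (τ : X → X) (κ : ℝ) : Prop where
  geo : IsGeodesicSpace X
  proper : IsProperAction G o
  infinite_order : ¬ IsOfFinOrder c
  nonneg : 0 ≤ κ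
  exists_zpow : ∀ x, ∃ i : ℤ, τ x = c ^ i • o
  dist_le : ∀ x (i : ℤ), dist x (τ x) ≤ dist x (c ^ i • o)
  equivariant : ∀ (i : ℤ) x, dist (τ (c ^ i • x)) (c ^ i • τ x) ≤ κ
  far : ∀ x x', κ < dist (τ x) (τ x') →
    dist x (τ x) + dist (τ x) (τ x') + dist (τ x') x' ≤ dist x x' + κ

section Construction

variable {G X : Type*} [Group G] [MetricSpace X] [MulAction G X] {o : X} {c : G}

omit [MetricSpace X] in
theorem mem_orbit_zpowers {y : X} :
    y ∈ MulAction.orbit (Subgroup.zpowers c) o ↔ ∃ i : ℤ, y = c ^ i • o := by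
  constructor
  · rintro ⟨⟨_, i, rfl⟩, rfl⟩
    exact ⟨i, rfl⟩
  · rintro ⟨i, rfl⟩
    exact ⟨⟨c ^ i, i, rfl⟩, rfl⟩

theorem mem_proj_iff {Y : Set X} {x y : X} (hy : y ∈ Y) :
    y ∈ proj Y x ↔ ∀ z ∈ Y, dist x y ≤ dist x z := by
  constructor
  · rintro ⟨-, h⟩ z hz
    exact h ▸ Metric.infDist_le_dist_of_mem hz
  · intro h
    exact ⟨hy, le_antisymm ((Metric.le_infDist ⟨y, hy⟩).2 fun z hz => h z hz)
      (Metric.infDist_le_dist_of_mem hy)⟩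

theorem proj_orbit_nonempty (hproper : IsProperAction G o) (x : X) :
    (proj (MulAction.orbit (Subgroup.zpowers c) o) x).Nonempty := by
  set Y := MulAction.orbit (Subgroup.zpowers c) o with hY
  have hYne : Y.Nonempty := MulAction.nonempty_orbit o
  set T := {y ∈ Y | dist x y ≤ Metric.infDist x Y + 1}
  have hT : T.Finite := by
    refine ((hproper x (Metric.infDist x Y + 1)).image (fun g => g • o)).subset ?_
    rintro y ⟨hy, hd⟩
    obtain ⟨i, rfl⟩ := mem_orbit_zpowers.1 hy
    exact ⟨c ^ i, hd, rfl⟩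
  have hTne : T.Nonempty := by
    obtain ⟨y, hy, hd⟩ := (Metric.infDist_lt_iff hYne).1 (lt_add_one (Metric.infDist x Y))
    exact ⟨y, hy, hd.le⟩
  obtain ⟨y, hy, hmin⟩ := Set.exists_min_image T (fun y => dist x y) hT hTne
  refine ⟨y, (mem_proj_iff hy.1).2 fun z hz => ?_⟩
  rcases le_or_gt (dist x z) (Metric.infDist x Y + 1) with h | h
  · exact hmin z ⟨hz, h⟩
  · exact hy.2.trans h.le

variable [IsIsometricSMul G X]

/-- Nearest points need not be unique, so an arbitrary choice of them is only coarsely equivariant: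
a translate of a nearest point is again nearest, and two nearest points of one point are close by
the contraction inequality. -/
theorem exists_axisProjection (hgeo : IsGeodesicSpace X) (hproper : IsProperAction G o)
    (hc : IsStronglyContractingElement o c) : ∃ τ κ, AxisProjection o c τ κ := by
  obtain ⟨hord, C, hC0, hC⟩ := hc
  set Y := MulAction.orbit (Subgroup.zpowers c) o with hY
  -- C may be 0, while the contraction lemmas need a positive constant.
  have hC' : IsStronglyContractingWith (C + 1) Y := fun x x' h p hp q hq =>
    (hC x x' h p hp q hq).trans (by linarith)
  have hne : ∀ x, (proj Y x).Nonempty := proj_orbit_nonempty hproper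
  choose τ hτ using hne
  have hpos : 0 < C + 1 := by linarith
  have hfar : ∀ {x x' y y' : X}, y ∈ proj Y x → y' ∈ proj Y x' → 32 * (C + 1) < dist y y' →
      dist x y + dist y y' + dist y' x' ≤ dist x x' + 32 * (C + 1) := fun hy hy' h =>
    dist_add_dist_add_dist_le hpos hgeo hC' (fun x => ⟨τ x, hτ x⟩) hy hy' h
  refine ⟨τ, 32 * (C + 1), hgeo, hproper, hord, by positivity,
    fun x => mem_orbit_zpowers.1 (hτ x).1,
    fun x i => (mem_proj_iff (hτ x).1).1 (hτ x) _ (mem_orbit_zpowers.2 ⟨i, rfl⟩),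
    fun i x => ?_, fun x x' h => hfar (hτ x) (hτ x') h⟩
  by_contra! h
  have hmem : c ^ i • τ x ∈ proj Y (c ^ i • x) := by
    obtain ⟨j, hj⟩ := mem_orbit_zpowers.1 (hτ x).1
    refine (mem_proj_iff (mem_orbit_zpowers.2 ⟨i + j, by rw [hj, smul_smul, zpow_add]⟩)).2 ?_
    intro z hz
    obtain ⟨k, rfl⟩ := mem_orbit_zpowers.1 hz
    have := (mem_proj_iff (hτ x).1).1 (hτ x) (c ^ (k - i) • o)
      (mem_orbit_zpowers.2 ⟨_, rfl⟩)
    rw [dist_smul]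
    rw [← dist_smul (c ^ i) x (c ^ (k - i) • o), smul_smul, ← zpow_add] at this
    simpa using this
  have := hfar (hτ (c ^ i • x)) hmem h
  rw [dist_self, zero_add] at this
  have e1 := dist_nonneg (x := c ^ i • x) (y := τ (c ^ i • x))
  have e2 := dist_nonneg (x := c ^ i • τ x) (y := c ^ i • x)
  linarith

end Construction

/-! ### Coarse geometry of the axis -/

namespace AxisProjection

variable {G X : Type*} [Group G] [MetricSpace X] [MulAction G X]
  {o : X} {c : G} {τ : X → X} {κ : ℝ}

theorem mono (h : AxisProjection o c τ κ) {κ' : ℝ} (hκ : κ ≤ κ') : AxisProjection o c τ κ' :=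
  ⟨h.geo, h.proper, h.infinite_order, h.nonneg.trans hκ, h.exists_zpow, h.dist_le,
    fun i x => (h.equivariant i x).trans hκ,
    fun x x' hx => (h.far x x' (hκ.trans_lt hx)).trans (by linarith)⟩

theorem apply_zpow (h : AxisProjection o c τ κ) (i : ℤ) : τ (c ^ i • o) = c ^ i • o := by
  have := h.dist_le (c ^ i • o) i
  rw [dist_self] at this
  exact (dist_le_zero.1 this).symm

theorem apply_base (h : AxisProjection o c τ κ) : τ o = o := by simpa using h.apply_zpow 0

theorem lipschitz (h : AxisProjection o c τ κ) (x x' : X) :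
    dist (τ x) (τ x') ≤ dist x x' + κ := by
  rcases le_or_gt (dist (τ x) (τ x')) κ with hk | hk
  · linarith [dist_nonneg (x := x) (y := x')]
  · linarith [h.far x x' hk, dist_nonneg (x := x) (y := τ x), dist_nonneg (x := τ x') (y := x')]

/-- A point almost between `x` and `x'`, whose projection is far from those of `x` and `x'`,
is close to the axis. -/
theorem near_of_between (h : AxisProjection o c τ κ) {x z x' : X} {ρ : ℝ}
    (h1 : κ < dist (τ x) (τ z)) (h2 : κ < dist (τ z) (τ x'))
    (hz : dist x z + dist z x' ≤ dist x x' + 2 * ρ) : dist z (τ z) ≤ κ + ρ := by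
  have e1 := h.far x z h1
  have e2 := h.far z x' h2
  have e3 := dist_triangle4 x (τ x) (τ x') x'
  have e4 := dist_triangle (τ x) (τ z) (τ x')
  rw [dist_comm (τ z) z] at e1
  linarith

/-- If the projection of z is far from both endpoints, z is between them and `near_of_between`
applies. If it is near an endpoint, the distance to that endpoint already bounds d(z, τ z); adding
the inequality for the other endpoint gives 2κ for twice the distance. -/
theorem quasiconvex (h : AxisProjection o c τ κ) {i j : ℤ} {z : X}
    (hz : dist (c ^ i • o) z + dist z (c ^ j • o) = dist (c ^ i • o) (c ^ j • o)) :
    dist z (τ z) ≤ κ := by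
  have e1 : dist z (τ z) ≤ dist (c ^ i • o) z := by
    rw [dist_comm (c ^ i • o)]
    exact h.dist_le z i
  have e2 := h.dist_le z j
  have t1 := dist_triangle (c ^ i • o) (τ z) (c ^ j • o)
  rcases le_or_gt (dist (c ^ i • o) (τ z)) κ with h1 | h1 <;>
  rcases le_or_gt (dist (τ z) (c ^ j • o)) κ with h2 | h2
  · linarith
  · have := h.far z (c ^ j • o) (by rwa [h.apply_zpow])
    rw [h.apply_zpow, dist_self] at this
    linarith
  · have := h.far (c ^ i • o) z (by rwa [h.apply_zpow])
    rw [h.apply_zpow, dist_self, dist_comm (τ z) z] at this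
    linarith
  · have := h.near_of_between (x := c ^ i • o) (x' := c ^ j • o) (z := z) (ρ := 0)
      (by rwa [h.apply_zpow]) (by rwa [h.apply_zpow]) (by linarith)
    linarith

theorem zpow_injective (h : AxisProjection o c τ κ) : Function.Injective fun i : ℤ => c ^ i :=
  injective_zpow_iff_not_isOfFinOrder.2 h.infinite_order

theorem finite_len_le (h : AxisProjection o c τ κ) (r : ℝ) : {g : G | len o g ≤ r}.Finite :=
  h.proper o r

theorem finite_zpow (h : AxisProjection o c τ κ) (r : ℝ) :
    {i : ℤ | len o (c ^ i) ≤ r}.Finite :=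
  (h.finite_len_le r).preimage h.zpow_injective.injOn

theorem exists_len_zpow_mul_gt (h : AxisProjection o c τ κ) {p : ℤ} (hp : p ≠ 0) (r : ℝ) :
    ∃ k : ℕ, 0 < k ∧ r < len o (c ^ (p * k)) := by
  by_contra! hcon
  have hinj : Function.Injective fun k : ℕ => p * ((k + 1 : ℕ) : ℤ) := by
    intro a b hab
    have := mul_left_cancel₀ hp hab
    omega
  refine Set.infinite_range_of_injective hinj ((h.finite_zpow r).subset ?_)
  rintro _ ⟨k, rfl⟩
  exact hcon (k + 1) k.succ_pos

variable [IsIsometricSMul G X]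

/-- Lengths of powers of `c` are coarsely additive. -/
theorem exists_coarse_additive (h : AxisProjection o c τ κ) : ∃ R : ℝ, 0 ≤ R ∧
    ∀ i l j : ℤ, i ≤ l → l ≤ j → dist (c ^ i • o) (c ^ l • o) + dist (c ^ l • o) (c ^ j • o) ≤
      dist (c ^ i • o) (c ^ j • o) + 2 * R := by
  -- Axis points within 2κ + 2 of each other have exponents differing by at most n, and D bounds the
  -- lengths of the powers in between.
  have hfin := h.finite_zpow (2 * κ + 2)
  obtain ⟨n, hn⟩ := hfin.bddAbove
  obtain ⟨D, hD⟩ := ((Set.finite_Icc (0 : ℤ) n).image fun k => len o (c ^ k)).bddAbove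
  have hD' : ∀ k : ℤ, 0 ≤ k → k ≤ n → len o (c ^ k) ≤ D := fun k h0 hk => hD ⟨k, ⟨h0, hk⟩, rfl⟩
  refine ⟨max 0 (κ + 1 + D), le_max_left _ _, fun i l j hil hlj => ?_⟩
  obtain ⟨γ, hγ0, hγ1, hγ⟩ := h.geo (c ^ i • o) (c ^ j • o)
  set L := dist (c ^ i • o) (c ^ j • o) with hL
  have hL0 : 0 ≤ L := dist_nonneg
  have m0 : (0 : ℝ) ∈ Set.Icc 0 L := ⟨le_rfl, hL0⟩
  have m1 : L ∈ Set.Icc 0 L := ⟨hL0, le_rfl⟩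
  have hstart : ∀ t ∈ Set.Icc 0 L, dist (c ^ i • o) (γ t) = t := fun t ht => by
    rw [← hγ0, hγ 0 m0 t ht, zero_sub, abs_neg, abs_of_nonneg ht.1]
  have hend : ∀ t ∈ Set.Icc 0 L, dist (γ t) (c ^ j • o) = L - t := fun t ht => by
    rw [← hγ1, hγ t ht L m1, abs_sub_comm, abs_of_nonneg (by linarith [ht.2])]
  have hcont : ContinuousOn γ (Set.Icc 0 L) := by
    rw [Metric.continuousOn_iff]
    intro b hb ε hε
    refine ⟨ε, hε, fun a ha hab => ?_⟩
    rw [hγ a ha b hb]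
    simpa [Real.dist_eq] using hab
  set P : Set X := (fun a : ℤ => c ^ a • o) '' Set.Iic l
  set Q : Set X := (fun a : ℤ => c ^ a • o) '' Set.Ici l
  have memP : ∀ a ≤ l, c ^ a • o ∈ P := fun a ha => ⟨a, ha, rfl⟩
  have memQ : ∀ a, l ≤ a → c ^ a • o ∈ Q := fun a ha => ⟨a, ha, rfl⟩
  have hP : P.Nonempty := ⟨_, memP l le_rfl⟩
  have hQ : Q.Nonempty := ⟨_, memQ l le_rfl⟩
  have hclosed : ∀ S : Set X, IsClosed (Set.Icc 0 L ∩ (fun t => Metric.infDist (γ t) S) ⁻¹'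
      Set.Iic κ) := fun S =>
    ((Metric.continuous_infDist_pt S).comp_continuousOn hcont).preimage_isClosed_of_isClosed
      isClosed_Icc isClosed_Iic
  have hpre : IsPreconnected (Set.Icc 0 L) := isPreconnected_Icc
  -- By quasiconvexity the geodesic is covered by the closed sets of points near powers at most l
  -- and near powers at least l. By connectedness some point is near both kinds, hence near c^l.
  obtain ⟨t, ht, ⟨-, htP⟩, -, htQ⟩ := isPreconnected_closed_iff.1 hpre _ _
    (hclosed P) (hclosed Q) (by
      intro t ht
      obtain ⟨a, ha⟩ := h.exists_zpow (γ t)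
      have hq := h.quasiconvex (i := i) (j := j) (z := γ t) (by rw [hstart t ht, hend t ht]; ring)
      rw [ha] at hq
      rcases le_total a l with hal | hal
      · exact Or.inl ⟨ht, (Metric.infDist_le_dist_of_mem (memP a hal)).trans hq⟩
      · exact Or.inr ⟨ht, (Metric.infDist_le_dist_of_mem (memQ a hal)).trans hq⟩)
    ⟨0, m0, m0, by
      rw [Set.mem_preimage, hγ0, Set.mem_Iic, Metric.infDist_zero_of_mem (memP i hil)]
      exact h.nonneg⟩
    ⟨L, m1, m1, by
      rw [Set.mem_preimage, hγ1, Set.mem_Iic, Metric.infDist_zero_of_mem (memQ j hlj)]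
      exact h.nonneg⟩
  obtain ⟨_, ⟨a, ha, rfl⟩, hda⟩ := (Metric.infDist_lt_iff hP).1
    (lt_of_le_of_lt htP (lt_add_one κ))
  obtain ⟨_, ⟨b, hb, rfl⟩, hdb⟩ := (Metric.infDist_lt_iff hQ).1
    (lt_of_le_of_lt htQ (lt_add_one κ))
  have hab : len o (c ^ (b - a)) ≤ 2 * κ + 2 := by
    rw [← dist_zpow_zpow]
    linarith [dist_triangle_left (c ^ a • o) (c ^ b • o) (γ t)]
  have hbn : b - a ≤ n := hn hab
  have hal : dist (c ^ a • o) (c ^ l • o) ≤ D := by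
    rw [dist_zpow_zpow]
    have h1 : a ≤ l := ha
    have h2 : l ≤ b := hb
    exact hD' _ (by omega) (by omega)
  have hgl : dist (γ t) (c ^ l • o) ≤ κ + 1 + D := by
    linarith [dist_triangle (γ t) (c ^ a • o) (c ^ l • o)]
  have e1 := dist_triangle (c ^ i • o) (γ t) (c ^ l • o)
  have e2 := dist_triangle_left (c ^ l • o) (c ^ j • o) (γ t)
  rw [hstart t ht] at e1
  rw [hend t ht] at e2
  linarith [le_max_right 0 (κ + 1 + D)]

/-- Powers of `c` grow at least linearly. -/
theorem exists_linear_growth (h : AxisProjection o c τ κ) : ∃ a b : ℝ, 0 ≤ a ∧ 0 ≤ b ∧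
    ∀ i : ℤ, |(i : ℝ)| ≤ a * (len o (c ^ i) + b) := by
  obtain ⟨R, hR, hadd⟩ := h.exists_coarse_additive
  have hadd' : ∀ p q : ℕ, len o (c ^ (p : ℤ)) + len o (c ^ (q : ℤ)) ≤
      len o (c ^ ((p + q : ℕ) : ℤ)) + 2 * R := by
    intro p q
    have := hadd 0 p ((p + q : ℕ) : ℤ) (by omega) (by omega)
    simp only [dist_zpow_zpow] at this
    simpa using this
  -- Each extra factor c^m gains more than 2R + 1 and loses at most 2R, so |c^(km)| ≥ k.
  obtain ⟨m, hm0, hm⟩ := h.exists_len_zpow_mul_gt one_ne_zero (2 * R + 1)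
  rw [one_mul] at hm
  have hk : ∀ k : ℕ, (k : ℝ) ≤ len o (c ^ ((k * m : ℕ) : ℤ)) := by
    intro k
    induction k with
    | zero => simpa using len_nonneg o (1 : G)
    | succ k ih =>
      have := hadd' (k * m) m
      rw [show (k + 1) * m = k * m + m by ring]
      push_cast at *
      linarith
  have hnat : ∀ i : ℕ, (i : ℝ) ≤ m * (len o (c ^ (i : ℤ)) + (2 * R + 1)) := by
    intro i
    have h1 := hk (i / m)
    have h2 := hadd' (i / m * m) (i % m)
    rw [Nat.div_add_mod'] at h2
    have h3 : i ≤ m * (i / m + 1) := (Nat.lt_mul_div_succ i hm0).le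
    have h4 : (i : ℝ) ≤ m * (((i / m : ℕ) : ℝ) + 1) := by exact_mod_cast h3
    refine h4.trans (mul_le_mul_of_nonneg_left ?_ (Nat.cast_nonneg m))
    linarith [len_nonneg o (c ^ ((i % m : ℕ) : ℤ))]
  refine ⟨m, 2 * R + 1, Nat.cast_nonneg m, by linarith, fun i => ?_⟩
  obtain ⟨n, rfl | rfl⟩ := i.eq_nat_or_neg
  · simpa using hnat n
  · rw [len_zpow_neg]
    simpa using hnat n

/-- The orbit of the base point under the elementary closure is close to the axis. -/
theorem near_of_mem_elementaryClosure (h : AxisProjection o c τ κ) {R : ℝ}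
    (hadd : ∀ i l j : ℤ, i ≤ l → l ≤ j →
      dist (c ^ i • o) (c ^ l • o) + dist (c ^ l • o) (c ^ j • o) ≤
        dist (c ^ i • o) (c ^ j • o) + 2 * R)
    {g : G} (hg : g ∈ elementaryClosure c) : dist (g • o) (τ (g • o)) ≤ κ + R := by
  obtain ⟨p, q, hp, hq, hpq⟩ := hg
  wlog hp' : 0 < p generalizing p q
  · refine this (-p) (-q) (by omega) (by omega) ?_ (by omega)
    rw [zpow_neg, zpow_neg, ← hpq]
    group
  obtain ⟨j, hj⟩ := h.exists_zpow (g • o)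
  -- The points g c^(±pk) o stay at distance |g| from the axis points c^(±qk) o. For k large their
  -- projections are far from that of g o, which lies almost between them.
  obtain ⟨k, -, hk⟩ := h.exists_len_zpow_mul_gt hq (κ + 2 * len o g + len o (c ^ j))
  have hclose : ∀ e : ℤ, dist ((g * c ^ (p * e)) • o) (c ^ (q * e) • o) = len o g := by
    intro e
    have h1 : c ^ (q * e) = g * c ^ (p * e) * g⁻¹ := by
      rw [zpow_mul, zpow_mul, ← hpq, conj_zpow]
    rw [h1, dist_smul_smul_eq_len]
    rw [← len_inv]
    congr 1
    group
  have hproj : ∀ e : ℤ, dist (τ ((g * c ^ (p * e)) • o)) (c ^ (q * e) • o) ≤ 2 * len o g := by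
    intro e
    have h1 := h.dist_le ((g * c ^ (p * e)) • o) (q * e)
    have h2 := hclose e
    linarith [dist_triangle_left (τ ((g * c ^ (p * e)) • o)) (c ^ (q * e) • o)
      ((g * c ^ (p * e)) • o)]
  have hfar : ∀ e : ℤ, len o (c ^ (q * k)) = len o (c ^ (q * e)) →
      κ < dist (τ ((g * c ^ (p * e)) • o)) (τ (g • o)) := by
    intro e he
    have h1 := hproj e
    rw [hj]
    rw [he] at hk
    have h2 := dist_triangle4 o (c ^ j • o) (τ ((g * c ^ (p * e)) • o)) (c ^ (q * e) • o)
    rw [dist_comm (c ^ j • o)] at h2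
    simp only [len] at *
    linarith
  refine h.near_of_between (x := (g * c ^ (p * (-(k : ℤ)))) • o) (x' := (g * c ^ (p * (k : ℤ))) • o)
    (hfar _ ?_) ?_ ?_
  · rw [mul_neg, len_zpow_neg]
  · rw [dist_comm]
    exact hfar _ rfl
  · have := hadd (p * (-(k : ℤ))) 0 (p * k) (by nlinarith) (by positivity)
    simp only [mul_smul, dist_smul]
    simpa using this

end AxisProjection

/-- A discrete intermediate value argument: the first crossing of T overshoots by at most one step.
It serves to select points with separated projections along a translated axis. -/
theorem exists_mem_Ioc_of_steps {φ : ℤ → ℝ} {s T : ℝ} (hs : ∀ l, φ (l + 1) ≤ φ l + s) {i j : ℤ}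
    (hij : i ≤ j) (hi : φ i ≤ T) (hj : T < φ j) : ∃ l, i ≤ l ∧ l ≤ j ∧ T < φ l ∧ φ l ≤ T + s := by
  induction j, hij using Int.leInduction with
  | base => linarith
  | succ j hij ih =>
    rcases lt_or_ge T (φ j) with h | h
    · obtain ⟨l, h1, h2, h3⟩ := ih h
      exact ⟨l, h1, by omega, h3⟩
    · exact ⟨j + 1, by omega, le_rfl, hj, by linarith [hs j]⟩

namespace AxisProjection

variable {G X : Type*} [Group G] [MetricSpace X] [MulAction G X] [IsIsometricSMul G X]
  {o : X} {c : G} {τ : X → X} {κ : ℝ}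

/-- Translates of the axis by elements outside of the elementary closure have uniformly bounded
projections. -/
theorem exists_bounded_projection (h : AxisProjection o c τ κ) : ∃ B : ℝ, ∀ g : G,
    g ∉ elementaryClosure c → ∀ i j : ℤ,
      dist (τ ((g * c ^ i) • o)) (τ ((g * c ^ j) • o)) ≤ B := by
  obtain ⟨R, hR, hadd⟩ := h.exists_coarse_additive
  have hfin := h.finite_len_le (κ + R)
  set F := hfin.toFinset with hF
  set s := len o c + κ with hs
  have hs0 : 0 ≤ s := add_nonneg (len_nonneg o c) h.nonneg
  refine ⟨2 * κ + (F.card + 2) * (s + 1), fun g hg i j => ?_⟩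
  wlog hij : i ≤ j generalizing i j
  · rw [dist_comm]
    exact this j i (by omega)
  by_contra! hB
  set f : ℤ → X := fun l => τ ((g * c ^ l) • o) with hf
  have hstep : ∀ l, dist (f i) (f (l + 1)) ≤ dist (f i) (f l) + s := by
    intro l
    have h1 := h.lipschitz ((g * c ^ l) • o) ((g * c ^ (l + 1)) • o)
    rw [mul_smul, mul_smul, dist_smul, dist_zpow_zpow, add_sub_cancel_left, zpow_one] at h1
    have h2 := dist_triangle (f i) (f l) (f (l + 1))
    simp only [hf, mul_smul] at h1 h2 ⊢
    linarith
  -- Levels are s + 1 apart and hit up to an error s, so distinct levels give distinct exponents.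
  -- The bound `hB` leaves more than κ beyond the last level.
  have hex : ∀ k : ℕ, k ≤ F.card → ∃ l, i ≤ l ∧ l ≤ j ∧ κ + k * (s + 1) < dist (f i) (f l) ∧
      dist (f i) (f l) ≤ κ + k * (s + 1) + s := by
    intro k hk
    have hk' : (k : ℝ) ≤ F.card := by exact_mod_cast hk
    refine exists_mem_Ioc_of_steps (φ := fun l => dist (f i) (f l)) hstep hij ?_ ?_
    · simp only [dist_self]
      have := h.nonneg
      positivity
    · refine lt_of_le_of_lt ?_ hB
      nlinarith [h.nonneg]
  choose! l hl1 hl2 hl3 hl4 using hex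
  have hnear : ∀ k ≤ F.card, dist ((g * c ^ l k) • o) (f (l k)) ≤ κ + R := by
    intro k hk
    have hk' : (k : ℝ) ≤ F.card := by exact_mod_cast hk
    have hk0 : (0 : ℝ) ≤ k := Nat.cast_nonneg k
    refine h.near_of_between (x := (g * c ^ i) • o) (x' := (g * c ^ j) • o) ?_ ?_ ?_
    · have := hl3 k hk
      have h2 : 0 ≤ (k : ℝ) * (s + 1) := by positivity
      linarith
    · have h2 := dist_triangle (f i) (f (l k)) (f j)
      have h3 := hl4 k hk
      have h4 : (k : ℝ) * (s + 1) ≤ F.card * (s + 1) := by gcongr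
      have h5 : 2 * κ + (F.card + 2) * (s + 1) < dist (f i) (f j) := hB
      have h6 := h.nonneg
      show κ < dist (f (l k)) (f j)
      nlinarith
    · simp only [mul_smul, dist_smul]
      exact hadd _ _ _ (hl1 k hk) (hl2 k hk)
  choose a ha using fun k => h.exists_zpow ((g * c ^ l k) • o)
  -- The selected points of the translate are close to the axis, so pigeonhole among finitely many
  -- short elements yields a relation g c^i g⁻¹ = c^j.
  have hmaps : ∀ k ∈ Finset.range (F.card + 1), (c ^ a k)⁻¹ * (g * c ^ l k) ∈ F := by
    intro k hk
    rw [hF, Set.Finite.mem_toFinset, Set.mem_ofPred_eq, ← dist_smul_smul_eq_len, ← ha k, dist_comm]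
    exact hnear k (by simpa [Nat.lt_succ_iff] using hk)
  obtain ⟨k, hk, k', hk', hne, heq⟩ := Finset.exists_ne_map_eq_of_card_lt_of_maps_to
    (by simp) hmaps
  have hkc : k ≤ F.card := by simpa [Nat.lt_succ_iff] using hk
  have hkc' : k' ≤ F.card := by simpa [Nat.lt_succ_iff] using hk'
  have hlne : l k ≠ l k' := by
    wlog hlt : k < k' generalizing k k'
    · exact (this k' hk' k hk hne.symm heq.symm hkc' hkc (by omega)).symm
    intro hll
    have h1 := hl4 k hkc
    have h2 := hl3 k' hkc'
    rw [hll] at h1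
    have h3 : (k : ℝ) + 1 ≤ k' := by exact_mod_cast hlt
    nlinarith
  have hconj : g * c ^ (l k - l k') * g⁻¹ = c ^ (a k - a k') := by
    have e1 : g * c ^ l k = c ^ a k * ((c ^ a k')⁻¹ * (g * c ^ l k')) := by
      rw [← heq]; group
    rw [zpow_sub, zpow_sub, ← mul_assoc, e1]
    group
  refine hg ⟨l k - l k', a k - a k', sub_ne_zero.2 hlne, fun h0 => ?_, hconj⟩
  rw [h0, zpow_zero, conj_eq_one_iff] at hconj
  exact hlne (sub_eq_zero.1 (h.zpow_injective (by simpa using hconj)))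

end AxisProjection

end Cogrowth

/-! ### Translates of the axis: transversality and the commensurator -/

namespace Cogrowth

/-- An axis projection whose constant `κ` also controls the translates of the axis: those by
elements of the elementary closure stay close to the axis, all others have small projection. -/
structure AxisSystem {G X : Type*} [Group G] [MetricSpace X] [MulAction G X]
    (o : X) (c : G) (τ : X → X) (κ : ℝ) : Prop extends AxisProjection o c τ κ where
  near : ∀ g ∈ elementaryClosure c, dist (g • o) (τ (g • o)) ≤ κ
  bounded : ∀ g ∉ elementaryClosure c, ∀ i j : ℤ,
    dist (τ ((g * c ^ i) • o)) (τ ((g * c ^ j) • o)) ≤ κ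

variable {G X : Type*} [Group G] [MetricSpace X] [MulAction G X] [IsIsometricSMul G X]
  {o : X} {c : G} {τ : X → X} {κ : ℝ}

theorem AxisProjection.exists_axisSystem (h : AxisProjection o c τ κ) :
    ∃ κ', AxisSystem o c τ κ' := by
  obtain ⟨R, hR, hadd⟩ := h.exists_coarse_additive
  obtain ⟨B, hB⟩ := h.exists_bounded_projection
  refine ⟨max (κ + R) B, h.mono ((le_add_of_nonneg_right hR).trans (le_max_left _ _)), ?_, ?_⟩
  · exact fun g hg => (h.near_of_mem_elementaryClosure hadd hg).trans (le_max_left _ _)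
  · exact fun g hg i j => (hB g hg i j).trans (le_max_right _ _)

namespace AxisSystem

/-- If the projection of `x` to the axis is far from that of a transverse translate of the axis,
then the projections of `x` and of the axis to the translate are close. -/
theorem transverse (h : AxisSystem o c τ κ) {g : G} (hg : g ∉ elementaryClosure c) {x : X}
    (hx : 2 * κ < dist (τ x) (τ (g • o))) : dist (τ (g⁻¹ • x)) (τ (g⁻¹ • o)) ≤ 2 * κ := by
  obtain ⟨j, hj⟩ := h.exists_zpow (g⁻¹ • x)
  obtain ⟨i, hi⟩ := h.exists_zpow x
  set v := (g * c ^ j) • o with hv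
  have hvo : dist (τ v) (τ (g • o)) ≤ κ := by simpa using h.bounded g hg j 0
  have hxv : κ < dist (τ x) (τ v) := by linarith [dist_triangle (τ x) (τ v) (τ (g • o))]
  have e1 := h.far x v hxv
  -- Here v is a point of the translate nearest to x, and `e1` makes x strictly closer to τ x than
  -- to v. Distant projections of x and τ x to the translate would give the opposite inequality.
  have e2 : dist (τ (g⁻¹ • x)) (τ (g⁻¹ • τ x)) ≤ κ := by
    by_contra! hc
    have e3 := h.far _ _ hc
    rw [dist_smul, hj, dist_inv_smul, smul_smul, ← hv] at e3
    rw [hj] at hc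
    linarith [dist_nonneg (x := τ v) (y := v),
      dist_nonneg (x := τ (g⁻¹ • τ x)) (y := g⁻¹ • τ x)]
  have e3 : dist (τ (g⁻¹ • τ x)) (τ (g⁻¹ • o)) ≤ κ := by
    rw [hi, smul_smul]
    simpa using h.bounded g⁻¹ (fun hm => hg (by simpa using inv_mem hm)) i 0
  linarith [dist_triangle (τ (g⁻¹ • x)) (τ (g⁻¹ • τ x)) (τ (g⁻¹ • o))]

/-- The element e moves the axis only a bounded amount, so e o is, like o, an almost nearest axis
point to x. This bounds the number of admissible elements in one coset of the commensurator. -/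
theorem len_le_of_mem_elementaryClosure (h : AxisSystem o c τ κ) {e : G}
    (he : e ∈ elementaryClosure c) {x : X} {K : ℝ} (h1 : dist (τ x) o ≤ K)
    (h2 : dist (τ (e⁻¹ • x)) o ≤ K) : len o e ≤ 2 * K + 3 * κ := by
  obtain ⟨i, hi⟩ := h.exists_zpow x
  obtain ⟨j, hj⟩ := h.exists_zpow ((e⁻¹ * c ^ i) • o)
  have e1 := h.near (e⁻¹ * c ^ i) (mul_mem (inv_mem he) (zpow_mem_elementaryClosure c i))
  have e2 := h.dist_le (e⁻¹ • x) j
  rw [← hj] at e2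
  have e3 : dist (e⁻¹ • x) ((e⁻¹ * c ^ i) • o) = dist x (τ x) := by
    rw [mul_smul, dist_smul, hi]
  have e4 := dist_triangle (e⁻¹ • x) ((e⁻¹ * c ^ i) • o) (τ ((e⁻¹ * c ^ i) • o))
  have e5 := dist_triangle (e⁻¹ • x) (τ (e⁻¹ • x)) o
  rw [dist_inv_smul] at e5
  have e6 := h.near e he
  have e7 : dist (τ x) (τ (e • o)) ≤ 2 * κ + K := by
    rcases le_or_gt (dist (τ x) (τ (e • o))) κ with hc | hc
    · linarith [h.nonneg, dist_nonneg.trans h1]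
    · have := h.far x (e • o) hc
      linarith [dist_nonneg (x := τ (e • o)) (y := e • o), dist_inv_smul e x o]
  have e8 := dist_triangle4 o (τ x) (τ (e • o)) (e • o)
  rw [dist_comm o (τ x), dist_comm (τ (e • o)) (e • o)] at e8
  rw [len]
  linarith

/-- An infinite subset of the elementary closure contains two distinct elements which differ by a
power of `c`. -/
theorem exists_mul_inv_eq_zpow (h : AxisSystem o c τ κ) {s : Set G} (hs : s.Infinite)
    (hsE : s ⊆ elementaryClosure c) : ∃ x ∈ s, ∃ y ∈ s, x ≠ y ∧ ∃ k : ℤ, x * y⁻¹ = c ^ k := by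
  choose i hi using fun g : G => h.exists_zpow (g • o)
  have hmaps : Set.MapsTo (fun g => (c ^ i g)⁻¹ * g) s {g | len o g ≤ κ} := by
    intro g hg
    rw [Set.mem_ofPred_eq, ← dist_smul_smul_eq_len, ← hi g, dist_comm]
    exact h.near g (hsE hg)
  obtain ⟨x, hx, y, hy, hne, heq⟩ := hs.exists_ne_map_eq_of_mapsTo hmaps (h.finite_len_le κ)
  refine ⟨x, hx, y, hy, hne, i x - i y, ?_⟩
  have : x = c ^ i x * ((c ^ i y)⁻¹ * y) := by
    rw [← heq]; group
  calc x * y⁻¹ = c ^ i x * ((c ^ i y)⁻¹ * y) * y⁻¹ := by rw [← this]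
    _ = _ := by rw [zpow_sub]; group

/-- An infinite normal subgroup contained in the elementary closure forces the latter to be
everything. -/
theorem exists_mem_not_mem_elementaryClosure (h : AxisSystem o c τ κ)
    (hne : ∃ g, g ∉ elementaryClosure c) (N : Subgroup G) [N.Normal] [Infinite N] :
    ∃ n ∈ N, n ∉ elementaryClosure c := by
  by_contra! hN
  obtain ⟨g, hg⟩ := hne
  have hNinf : (N : Set G).Infinite := Set.infinite_coe_iff.1 ‹_›
  obtain ⟨x, hx, y, hy, hxy, k, hk⟩ := h.exists_mul_inv_eq_zpow hNinf hN
  have hkN : c ^ k ∈ N := hk ▸ mul_mem hx (inv_mem hy)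
  have hk0 : k ≠ 0 := by
    rintro rfl
    exact hxy (mul_inv_eq_one.1 (by simpa using hk))
  -- N now contains a nontrivial c^k, hence all conjugates g c^(kj) g⁻¹. Two of these differ by a
  -- power of c, which puts g in the commensurator.
  have hinj : Function.Injective fun j : ℤ => g * c ^ (k * j) * g⁻¹ := by
    intro a b hab
    have : c ^ (k * a) = c ^ (k * b) := by simpa using hab
    exact mul_left_cancel₀ hk0 (h.zpow_injective this)
  obtain ⟨_, ⟨a, rfl⟩, _, ⟨b, rfl⟩, hab, q, hq⟩ := h.exists_mul_inv_eq_zpow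
    (Set.infinite_range_of_injective hinj) (by
      rintro _ ⟨j, rfl⟩
      exact hN _ (Subgroup.Normal.conj_mem ‹_› _ (by rw [zpow_mul]; exact zpow_mem hkN j) g))
  have hconj : g * c ^ (k * (a - b)) * g⁻¹ = c ^ q := by
    rw [← hq, mul_sub, zpow_sub]
    group
  have hab' : a - b ≠ 0 := fun h0 => hab (by rw [sub_eq_zero.1 h0])
  refine hg ⟨k * (a - b), q, mul_ne_zero hk0 hab', ?_, hconj⟩
  rintro rfl
  rw [zpow_zero, conj_eq_one_iff] at hconj
  exact mul_ne_zero hk0 hab' (h.zpow_injective (by simpa using hconj))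

/-- The elementary closure has at most linear growth. -/
theorem exists_linear_bound (h : AxisSystem o c τ κ) : ∃ a b : ℝ, 0 ≤ a ∧ ∀ t : ℝ, 0 ≤ t →
    ({g | g ∈ elementaryClosure c ∧ len o g ≤ t}.ncard : ℝ) ≤ a * t + b := by
  classical
  obtain ⟨a, b, ha, hb, hab⟩ := h.exists_linear_growth
  set F := (h.finite_len_le κ).toFinset
  refine ⟨2 * a * F.card, (2 * a * (κ + b) + 1) * F.card, by positivity, fun t ht => ?_⟩
  set n : ℕ := ⌊a * (t + κ + b)⌋₊ with hn
  set T : Finset G := Finset.image₂ (fun (i : ℤ) f => c ^ i * f) (Finset.Icc (-(n : ℤ)) n) F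
  have hsub : {g | g ∈ elementaryClosure c ∧ len o g ≤ t} ⊆ (T : Set G) := by
    rintro g ⟨hg, hgt⟩
    obtain ⟨i, hi⟩ := h.exists_zpow (g • o)
    have h1 := h.near g hg
    rw [hi] at h1
    have h2 : len o (c ^ i) ≤ t + κ := by
      have := dist_triangle o (g • o) (c ^ i • o)
      simp only [len] at *
      linarith
    have h3 : (i.natAbs : ℝ) ≤ a * (t + κ + b) := by
      rw [Nat.cast_natAbs, Int.cast_abs]
      exact (hab i).trans (mul_le_mul_of_nonneg_left (by linarith) ha)
    have h4 : i.natAbs ≤ n := Nat.le_floor h3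
    refine Finset.mem_coe.2 (Finset.mem_image₂.2
      ⟨i, Finset.mem_Icc.2 ⟨by omega, by omega⟩, (c ^ i)⁻¹ * g, ?_, by group⟩)
    rw [Set.Finite.mem_toFinset, Set.mem_ofPred_eq, ← dist_smul_smul_eq_len, dist_comm]
    exact h1
  have hcard : {g | g ∈ elementaryClosure c ∧ len o g ≤ t}.ncard ≤ (2 * n + 1) * F.card := by
    refine (Set.ncard_le_ncard hsub T.finite_toSet).trans ?_
    rw [Set.ncard_coe_finset]
    refine (Finset.card_image₂_le _ _ _).trans (le_of_eq ?_)
    rw [Int.card_Icc]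
    congr 1
    omega
  have hfl : (n : ℝ) ≤ a * (t + κ + b) := Nat.floor_le (by have := h.nonneg; positivity)
  calc (_ : ℝ) ≤ (2 * n + 1) * F.card := by exact_mod_cast hcard
    _ ≤ (2 * (a * (t + κ + b)) + 1) * F.card := by gcongr
    _ = _ := by ring

end AxisSystem

theorem eventually_linear_le_exp (a b : ℝ) {δ ε : ℝ} (hδ : 0 < δ) (hε : 0 < ε) :
    ∀ᶠ t : ℝ in atTop, a * t + b ≤ ε * Real.exp (δ * t) := by
  have h1 := (isLittleO_pow_exp_pos_mul_atTop (k := 1) hδ).const_mul_left a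
  have h0 := (isLittleO_pow_exp_pos_mul_atTop (k := 0) hδ).const_mul_left b
  filter_upwards [(h1.add h0).bound hε] with t ht
  simp only [pow_one, pow_zero, mul_one, Real.norm_eq_abs, Real.abs_exp] at ht
  exact (le_abs_self _).trans ht

/-! ### From counting orbit points to counting group elements -/

section Counting

/-- The number of group elements of length at most `t` is at most `M * exp (δ * t)`, and the
number of those of length in `[r, r + Δ)` is at least `exp (δ * r) / M`. -/
structure HasShellGrowth (G : Type*) {X : Type*} [Group G] [MetricSpace X] [MulAction G X]
    (o : X) (δ Δ M : ℝ) : Prop where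
  rate_pos : 0 < δ
  width_pos : 0 < Δ
  const_pos : 0 < M
  upper : ∀ t : ℝ, ({g : G | len o g ≤ t}.ncard : ℝ) ≤ M * Real.exp (δ * t)
  lower : ∀ r : ℝ, 0 ≤ r →
    Real.exp (δ * r) / M ≤ ({g : G | r ≤ len o g ∧ len o g < r + Δ}.ncard : ℝ)

omit [IsIsometricSMul G X] in
theorem orbit_inter_shell (r Δ : ℝ) : MulAction.orbit G o ∩ shell o r Δ =
    (fun g : G => g • o) '' {g | r ≤ len o g ∧ len o g < r + Δ} := by
  ext x
  simp only [shell, Set.mem_inter_iff, Set.mem_sdiff, Metric.mem_ball, not_lt, Set.mem_image,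
    Set.mem_ofPred_eq, len]
  constructor
  · rintro ⟨⟨g, rfl⟩, h1, h2⟩
    exact ⟨g, ⟨by rwa [dist_comm], by rwa [dist_comm]⟩, rfl⟩
  · rintro ⟨g, ⟨h1, h2⟩, rfl⟩
    exact ⟨⟨g, rfl⟩, by rwa [dist_comm], by rwa [dist_comm]⟩

/-- Fibres of the orbit map are cosets of the stabilizer of `o`, which is finite by properness. -/
theorem ncard_le_mul_ncard_image (hproper : IsProperAction G o) {s : Set G} (hs : s.Finite) :
    s.ncard ≤ {g : G | len o g ≤ 0}.ncard * ((fun g : G => g • o) '' s).ncard := by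
  classical
  obtain ⟨s, rfl⟩ := hs.exists_finset_coe
  rw [← Finset.coe_image, Set.ncard_coe_finset, Set.ncard_coe_finset]
  refine Finset.card_le_mul_card_image s _ fun x hx => ?_
  obtain ⟨g, hg, rfl⟩ := Finset.mem_image.1 hx
  rw [← Set.ncard_coe_finset]
  refine Set.ncard_le_ncard_of_injOn (fun a => g⁻¹ * a) (fun a ha => ?_)
    (mul_right_injective _).injOn (hproper o 0)
  have h1 : a • o = g • o := (Finset.mem_filter.1 (Finset.mem_coe.1 ha)).2
  rw [Set.mem_ofPred_eq, ← dist_smul_smul_eq_len, h1, dist_self]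

/-- A ball is covered by ⌊t/Δ⌋ + 1 shells, and the geometric sum of ratio exp(δΔ) is dominated by
its last term. The stabilizer enters only the upper bound. -/
theorem exists_hasShellGrowth (hproper : IsProperAction G o)
    (hgrowth : HasPurelyExponentialGrowth o (MulAction.orbit G o)) :
    ∃ δ Δ M, HasShellGrowth G o δ Δ M := by
  obtain ⟨δ, hδ, Δ, hΔ, C, hC, hr⟩ := hgrowth
  have hfin : ∀ t, {g : G | len o g ≤ t}.Finite := fun t => hproper o t
  have hfin' : ∀ r, {g : G | r ≤ len o g ∧ len o g < r + Δ}.Finite := fun r =>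
    (hfin (r + Δ)).subset fun g hg => hg.2.le
  set S : ℝ := ({g : G | len o g ≤ 0}.ncard : ℝ) with hS
  have hshell : ∀ r, 0 ≤ r → ({g : G | r ≤ len o g ∧ len o g < r + Δ}.ncard : ℝ) ≤
      S * (C * Real.exp (δ * r)) := by
    intro r hr0
    have h1 := ncard_le_mul_ncard_image hproper (hfin' r)
    rw [← orbit_inter_shell] at h1
    calc _ ≤ S * ((MulAction.orbit G o ∩ shell o r Δ).ncard : ℝ) := by
          rw [hS]; exact_mod_cast h1
      _ ≤ _ := mul_le_mul_of_nonneg_left (hr r hr0).2 (Nat.cast_nonneg _)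
  have hS0 : 0 ≤ S := Nat.cast_nonneg _
  set q := Real.exp (δ * Δ) with hq
  have hq1 : 1 < q := Real.one_lt_exp_iff.2 (by positivity)
  set M := S * C * q / (q - 1) + C with hM
  have hM1 : 0 ≤ S * C * q / (q - 1) := by
    have : 0 < q - 1 := by linarith
    positivity
  have hMpos : 0 < M := by positivity
  refine ⟨δ, Δ, M, hδ, hΔ, hMpos, fun t => ?_, fun r hr0 => ?_⟩
  · rcases lt_or_ge t 0 with ht | ht
    · have : {g : G | len o g ≤ t} = ∅ := by
        ext g
        simpa using lt_of_lt_of_le ht (len_nonneg o g)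
      rw [this]
      simp only [Set.ncard_empty, Nat.cast_zero]
      positivity
    set n := ⌊t / Δ⌋₊ + 1 with hn
    have hsub : {g : G | len o g ≤ t} ⊆ ⋃ k ∈ Finset.range n,
        {g : G | k * Δ ≤ len o g ∧ len o g < k * Δ + Δ} := by
      intro g hg
      have hg0 := len_nonneg o g
      simp only [Set.mem_iUnion, Finset.mem_range]
      refine ⟨⌊len o g / Δ⌋₊, Nat.lt_succ_of_le (Nat.floor_le_floor (by gcongr; exact hg)), ?_, ?_⟩
      · rw [← le_div_iff₀ hΔ]
        exact Nat.floor_le (by positivity)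
      · have := Nat.lt_floor_add_one (len o g / Δ)
        rw [div_lt_iff₀ hΔ] at this
        linarith
    have h1 : {g : G | len o g ≤ t}.ncard ≤ ∑ k ∈ Finset.range n,
        {g : G | k * Δ ≤ len o g ∧ len o g < k * Δ + Δ}.ncard :=
      (Set.ncard_le_ncard hsub (Set.Finite.biUnion (Finset.finite_toSet _)
        fun k _ => hfin' _)).trans (Finset.set_ncard_biUnion_le _ _)
    have h2 : (∑ k ∈ Finset.range n, q ^ k) ≤ q * Real.exp (δ * t) / (q - 1) := by
      rw [geom_sum_eq hq1.ne']
      have : 0 < q - 1 := by linarith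
      gcongr
      have : q ^ n ≤ q * Real.exp (δ * t) := by
        rw [hn, pow_succ', hq, ← Real.exp_nat_mul]
        have := Nat.floor_le (div_nonneg ht hΔ.le)
        rw [le_div_iff₀ hΔ] at this
        have h3 : (⌊t / Δ⌋₊ : ℝ) * (δ * Δ) ≤ δ * t := by
          calc _ = δ * (⌊t / Δ⌋₊ * Δ) := by ring
            _ ≤ _ := by gcongr
        gcongr
      linarith
    calc _ ≤ ∑ k ∈ Finset.range n,
        ({g : G | k * Δ ≤ len o g ∧ len o g < k * Δ + Δ}.ncard : ℝ) := by exact_mod_cast h1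
      _ ≤ ∑ k ∈ Finset.range n, S * C * q ^ k := by
        refine Finset.sum_le_sum fun k _ => (hshell _ (by positivity)).trans (le_of_eq ?_)
        rw [hq, ← Real.exp_nat_mul, mul_assoc]
        congr 3
        ring
      _ = S * C * ∑ k ∈ Finset.range n, q ^ k := by rw [Finset.mul_sum]
      _ ≤ S * C * (q * Real.exp (δ * t) / (q - 1)) := by gcongr
      _ = S * C * q / (q - 1) * Real.exp (δ * t) := by ring
      _ ≤ M * Real.exp (δ * t) := by
        gcongr
        linarith
  · have h1 : (MulAction.orbit G o ∩ shell o r Δ).ncard ≤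
        {g : G | r ≤ len o g ∧ len o g < r + Δ}.ncard := by
      rw [orbit_inter_shell]
      exact Set.ncard_image_le (hfin' r)
    calc _ ≤ Real.exp (δ * r) / C := by
          gcongr
          linarith
      _ ≤ _ := (hr r hr0).1
      _ ≤ _ := by exact_mod_cast h1

end Counting

namespace AxisSystem

variable {δ Δ M : ℝ}

theorem exists_not_mem_elementaryClosure (h : AxisSystem o c τ κ)
    (hG : HasShellGrowth G o δ Δ M) : ∃ g, g ∉ elementaryClosure c := by
  by_contra! hE
  obtain ⟨a, b, -, hab⟩ := h.exists_linear_bound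
  have hM := hG.const_pos
  obtain ⟨t, ht, ht0⟩ := ((eventually_linear_le_exp a (a * Δ + b + 1) hG.rate_pos
    (inv_pos.2 hM)).and (eventually_ge_atTop 0)).exists
  have h1 := hG.lower t ht0
  have h2 := hab (t + Δ) (add_nonneg ht0 hG.width_pos.le)
  have h3 : {g : G | t ≤ len o g ∧ len o g < t + Δ}.ncard ≤
      {g | g ∈ elementaryClosure c ∧ len o g ≤ t + Δ}.ncard :=
    Set.ncard_le_ncard (fun g hg => ⟨hE g, hg.2.le⟩)
      ((h.finite_len_le (t + Δ)).subset fun g hg => hg.2)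
  have h4 : ({g : G | t ≤ len o g ∧ len o g < t + Δ}.ncard : ℝ) ≤
      {g | g ∈ elementaryClosure c ∧ len o g ≤ t + Δ}.ncard := by exact_mod_cast h3
  rw [div_eq_inv_mul] at h1
  linarith

end AxisSystem

end Cogrowth

/-! ### Ping-pong with the words g u g⁻¹ u -/

namespace Cogrowth

/-- `g` is transverse to the axis, and the projections of `g • o` and `g⁻¹ • o` to the axis are
`K`-close to the base point. -/
structure IsAdmissible {G X : Type*} [Group G] [MetricSpace X] [MulAction G X]
    (o : X) (c : G) (τ : X → X) (K : ℝ) (g : G) : Prop where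
  not_mem : g ∉ elementaryClosure c
  dist_le : dist (τ (g • o)) o ≤ K
  dist_inv_le : dist (τ (g⁻¹ • o)) o ≤ K

theorem IsAdmissible.inv {G X : Type*} [Group G] [MetricSpace X] [MulAction G X]
    {o : X} {c : G} {τ : X → X} {K : ℝ} {g : G} (hg : IsAdmissible o c τ K g) :
    IsAdmissible o c τ K g⁻¹ :=
  ⟨fun h => hg.not_mem (by simpa using inv_mem h), hg.dist_inv_le, by simpa using hg.dist_le⟩

/-- The product of a conjugate of `u` with `u`. -/
def conjWord {G : Type*} [Group G] (u g : G) : G := g * u * g⁻¹ * u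

theorem conjWord_smul {G X : Type*} [Group G] [MulAction G X] (c g n : G) (m : ℤ) (x : X) : conjWord (c ^ m * n * c ^ (-m)) g • x =
    g • c ^ m • n • c ^ (-m) • g⁻¹ • c ^ m • n • c ^ (-m) • x := by
  simp only [conjWord, smul_smul]
  congr 1
  group

/-- The element `b` lies in the shadow of the segment of length `len o f` starting at `a`. -/
def InShadow {G X : Type*} [Group G] [MetricSpace X] [MulAction G X] (o : X) (s : ℝ) (f a b : G) : Prop :=
  len o a + len o f + len o ((a * f)⁻¹ * b) ≤ len o b + s

variable {G X : Type*} [Group G] [MetricSpace X] [MulAction G X] [IsIsometricSMul G X]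
  {o : X} {c : G} {τ : X → X} {κ : ℝ}

namespace AxisSystem

variable {K : ℝ} {g g' n : G} {m : ℤ} {x z : X}

theorem dist_proj_zpow_smul (h : AxisSystem o c τ κ) (e : ℤ) (hx : dist (τ x) o ≤ K + 2 * κ) :
    dist (τ (c ^ e • x)) (c ^ e • o) ≤ K + 3 * κ := by
  have h1 := h.equivariant e x
  have h2 := dist_triangle (τ (c ^ e • x)) (c ^ e • τ x) (c ^ e • o)
  rw [dist_smul] at h2
  linarith

/-- Ping-pong: long powers of `c` followed by admissible elements preserve the set of points
projecting close to the base point. -/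
theorem dist_proj_smul_zpow_smul_le (h : AxisSystem o c τ κ) (hg : IsAdmissible o c τ K g) {e : ℤ}
    (he : 2 * K + 5 * κ < len o (c ^ e)) (hx : dist (τ x) o ≤ K + 2 * κ) :
    dist (τ (g • c ^ e • x)) o ≤ K + 2 * κ := by
  by_contra! hc
  have h1 := dist_triangle (τ (g • c ^ e • x)) (τ (g • o)) o
  have h2 := h.transverse hg.not_mem (x := g • c ^ e • x) (by linarith [hg.dist_le])
  rw [inv_smul_smul] at h2
  have h3 := h.dist_proj_zpow_smul e hx
  have h5 := hg.dist_inv_le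
  have h6 := dist_triangle4 o (τ (g⁻¹ • o)) (τ (c ^ e • x)) (c ^ e • o)
  rw [dist_comm o (τ (g⁻¹ • o)), dist_comm (τ (g⁻¹ • o)) (τ (c ^ e • x))] at h6
  rw [len] at he
  linarith

theorem dist_proj_conj_smul_le (h : AxisSystem o c τ κ) (hn : IsAdmissible o c τ K n)
    (hm : 2 * K + 5 * κ < len o (c ^ m)) (hg : IsAdmissible o c τ K g)
    (hx : dist (τ x) o ≤ K + 2 * κ) :
    dist (τ (g • c ^ m • n • c ^ (-m) • x)) o ≤ K + 2 * κ :=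
  h.dist_proj_smul_zpow_smul_le hg hm
    (h.dist_proj_smul_zpow_smul_le hn (by rwa [len_zpow_neg]) hx)

theorem dist_proj_conjWord_smul_le (h : AxisSystem o c τ κ) (hn : IsAdmissible o c τ K n)
    (hm : 2 * K + 5 * κ < len o (c ^ m)) (hg : IsAdmissible o c τ K g)
    (hx : dist (τ x) o ≤ K + 2 * κ) :
    dist (τ (conjWord (c ^ m * n * c ^ (-m)) g • x)) o ≤ K + 2 * κ := by
  rw [conjWord_smul]
  exact h.dist_proj_conj_smul_le hn hm hg (h.dist_proj_conj_smul_le hn hm hg.inv hx)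

/-- Two transverse translates of the axis along which a point projects far are ordered. -/
theorem ordered_of_dist_proj_le (h : AxisSystem o c τ κ) {a b : G}
    (hab : a⁻¹ * b ∉ elementaryClosure c) {p : X}
    (ha : dist (τ (a⁻¹ • z)) p ≤ K + 3 * κ) (hb : dist (τ (b⁻¹ • z)) p ≤ K + 3 * κ) :
    dist (τ (a⁻¹ • b • o)) p ≤ K + 5 * κ ∨ dist (τ (b⁻¹ • a • o)) p ≤ K + 5 * κ := by
  rcases le_or_gt (dist (τ (a⁻¹ • z)) (τ (a⁻¹ • b • o))) (2 * κ) with hc | hc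
  · left
    linarith [dist_triangle_left (τ (a⁻¹ • b • o)) p (τ (a⁻¹ • z))]
  · right
    rw [smul_smul] at hc
    have := h.transverse hab hc
    simp only [smul_smul, mul_inv_rev, inv_inv, mul_inv_cancel_right] at this
    rw [← smul_smul b⁻¹ a o] at this
    linarith [dist_triangle_left (τ (b⁻¹ • a • o)) p (τ (b⁻¹ • z))]

/-- A path from o to p must follow the translated axis from about a o to about a c^m o. The two
projection errors K + 3κ and K + 5κ are each paid twice, plus κ from `far`. -/
theorem len_add_len_add_dist_le (h : AxisSystem o c τ κ) {a : G} {p : X}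
    (hm : 2 * K + 9 * κ < len o (c ^ m)) (h1 : dist (τ (a⁻¹ • o)) o ≤ K + 3 * κ)
    (h2 : dist (τ (a⁻¹ • p)) (c ^ m • o) ≤ K + 5 * κ) :
    len o a + len o (c ^ m) + dist ((a * c ^ m) • o) p ≤ dist o p + (4 * K + 17 * κ) := by
  have e1 := dist_triangle4_right o (c ^ m • o) (τ (a⁻¹ • o)) (τ (a⁻¹ • p))
  rw [dist_comm o (τ (a⁻¹ • o)), dist_comm (c ^ m • o)] at e1
  rw [len] at hm
  have e2 := h.far (a⁻¹ • o) (a⁻¹ • p) (by linarith)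
  rw [dist_smul] at e2
  have e3 := dist_triangle (a⁻¹ • o) (τ (a⁻¹ • o)) o
  rw [dist_inv_smul] at e3
  have e4 := dist_triangle_left (c ^ m • o) (a⁻¹ • p) (τ (a⁻¹ • p))
  rw [← dist_smul a (c ^ m • o), smul_inv_smul, smul_smul] at e4
  rw [len, len]
  linarith

/-- Words in admissible elements of almost equal length in distinct cosets of the elementary
closure act with disjoint images. -/
theorem conjWord_smul_ne_of_not_mem (h : AxisSystem o c τ κ) (hn : IsAdmissible o c τ K n)
    {Δ : ℝ} (hm : 4 * K + 17 * κ + Δ ≤ len o (c ^ m)) (hm' : 2 * K + 9 * κ < len o (c ^ m))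
    (hg : IsAdmissible o c τ K g) (hg' : IsAdmissible o c τ K g')
    (hne : g⁻¹ * g' ∉ elementaryClosure c) (hΔ : |len o g - len o g'| < Δ) {x x' : X}
    (hx : dist (τ x) o ≤ K + 2 * κ) (hx' : dist (τ x') o ≤ K + 2 * κ) :
    conjWord (c ^ m * n * c ^ (-m)) g • x ≠ conjWord (c ^ m * n * c ^ (-m)) g' • x' := by
  intro heq
  have hκ := h.nonneg
  have hm1 : 2 * K + 5 * κ < len o (c ^ m) := by linarith
  have hend : ∀ f : G, IsAdmissible o c τ K f → ∀ y, dist (τ y) o ≤ K + 2 * κ →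
      dist (τ (f⁻¹ • conjWord (c ^ m * n * c ^ (-m)) f • y)) (c ^ m • o) ≤ K + 3 * κ := by
    intro f hf y hy
    rw [conjWord_smul, inv_smul_smul]
    exact h.dist_proj_zpow_smul m (h.dist_proj_smul_zpow_smul_le hn (by rwa [len_zpow_neg])
      (h.dist_proj_conj_smul_le hn hm1 hf.inv hy))
  have hend' := hend g' hg' x' hx'
  rw [← heq] at hend'
  obtain ⟨hΔ1, hΔ2⟩ := abs_lt.1 hΔ
  -- Whichever translate comes first, the other of g, g' is longer by at least |c^m| - (4K + 17κ) ≥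
  -- Δ.
  rcases h.ordered_of_dist_proj_le hne (hend g hg x hx) hend' with hc | hc
  · have := h.len_add_len_add_dist_le hm' (by linarith [hg.dist_inv_le]) hc
    rw [← len] at this
    linarith [dist_nonneg (x := (g * c ^ m) • o) (y := g' • o)]
  · have := h.len_add_len_add_dist_le hm' (by linarith [hg'.dist_inv_le]) hc
    rw [← len] at this
    linarith [dist_nonneg (x := (g' * c ^ m) • o) (y := g • o)]

/-- Words in admissible elements of very different lengths act with disjoint images, unless the
longer one lies in the shadow of the conjugate of `u` by the shorter one. -/
theorem conjWord_smul_ne_of_not_inShadow (h : AxisSystem o c τ κ) (hn : IsAdmissible o c τ K n)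
    (hm : 2 * K + 9 * κ < len o (c ^ m))
    (hg : IsAdmissible o c τ K g) (hg' : IsAdmissible o c τ K g')
    (hlen : 2 * len o g + len o (c ^ m * n * c ^ (-m)) + (4 * K + 17 * κ) < len o g')
    (hsh : ¬ InShadow o (4 * K + 17 * κ) (c ^ m) (g * (c ^ m * n * c ^ (-m)) * g⁻¹) g')
    {x x' : X} (hx : dist (τ x) o ≤ K + 2 * κ) (hx' : dist (τ x') o ≤ K + 2 * κ) :
    conjWord (c ^ m * n * c ^ (-m)) g • x ≠ conjWord (c ^ m * n * c ^ (-m)) g' • x' := by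
  intro heq
  have hκ := h.nonneg
  have hK : 0 ≤ K := dist_nonneg.trans hn.dist_le
  have hm1 : 2 * K + 5 * κ < len o (c ^ m) := by linarith
  have hm2 : 2 * K + 5 * κ < len o (c ^ (-m)) := by rwa [len_zpow_neg]
  set u := c ^ m * n * c ^ (-m) with hu
  set a := g * u * g⁻¹ with ha
  have hlena : len o a ≤ 2 * len o g + len o u := by
    have h1 := len_mul_le o (g * u) g⁻¹
    have h2 := len_mul_le o g u
    rw [len_inv] at h1
    linarith
  have hainv : a⁻¹ • o = g • c ^ m • n⁻¹ • c ^ (-m) • g⁻¹ • o := by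
    simp only [smul_smul, ha, hu]
    congr 1
    group
  have hstart : dist (τ (a⁻¹ • o)) o ≤ K + 3 * κ := by
    have := h.dist_proj_conj_smul_le hn.inv hm1 hg (x := g⁻¹ • o) (by linarith [hg.dist_inv_le])
    rw [hainv]
    linarith
  have hend : dist (τ (a⁻¹ • conjWord u g • x)) (c ^ m • o) ≤ K + 3 * κ := by
    have h1 : a⁻¹ • conjWord u g • x = c ^ m • n • c ^ (-m) • x := by
      rw [conjWord, ← ha, mul_smul, inv_smul_smul, hu, mul_smul, mul_smul]
    rw [h1]
    exact h.dist_proj_zpow_smul m (h.dist_proj_smul_zpow_smul_le hn hm2 hx)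
  have hend' : dist (τ (g'⁻¹ • conjWord u g • x)) (c ^ m • o) ≤ K + 3 * κ := by
    rw [heq, hu, conjWord_smul, inv_smul_smul]
    exact h.dist_proj_zpow_smul m (h.dist_proj_smul_zpow_smul_le hn hm2
      (h.dist_proj_conj_smul_le hn hm1 hg'.inv hx'))
  -- Compare the axes at a = g u g⁻¹, where the second u of the short word starts, and at g'. If
  -- they nearly coincide, or that of g' comes first, then g' is too short for `hlen`; if that of a
  -- comes first, g' lies in the shadow.
  by_cases hE : a⁻¹ * g' ∈ elementaryClosure c
  · have hE' : g'⁻¹ * a ∈ elementaryClosure c := by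
      have := inv_mem hE
      rwa [mul_inv_rev, inv_inv] at this
    obtain ⟨i, hi⟩ := h.exists_zpow ((g'⁻¹ * a) • o)
    have h1 := h.near _ hE'
    have h2 := h.dist_le (g'⁻¹ • o) i
    have h3 := dist_triangle (g'⁻¹ • o) (τ (g'⁻¹ • o)) o
    have h4 := dist_triangle (g'⁻¹ • o) ((g'⁻¹ * a) • o) (c ^ i • o)
    rw [hi] at h1
    rw [mul_smul, dist_smul, ← mul_smul, ← len] at h4
    rw [dist_inv_smul, ← len] at h3
    linarith [hg'.dist_inv_le]
  · rcases h.ordered_of_dist_proj_le hE hend hend' with hc | hc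
    · apply hsh
      have := h.len_add_len_add_dist_le hm hstart hc
      rwa [dist_smul_smul_eq_len, ← len] at this
    · have := h.len_add_len_add_dist_le hm (by linarith [hg'.dist_inv_le]) hc
      rw [← len] at this
      linarith [dist_nonneg (x := (g' * c ^ m) • o) (y := a • o)]

/-- This places the apex of the shadow at distance about 2|g|, the source of the gain exp(-δ|g|).
The path to g u g⁻¹ o runs along g and g c^m, and the |c^m| gained there cancels the loss in the
remaining piece, so the error is independent of m. -/
theorem two_mul_len_le_len_conj (h : AxisSystem o c τ κ) (hn : IsAdmissible o c τ K n)
    (hm : 2 * K + 9 * κ < len o (c ^ m)) (hg : IsAdmissible o c τ K g) :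
    2 * len o g ≤ len o (g * (c ^ m * n * c ^ (-m)) * g⁻¹) + len o n + (4 * K + 17 * κ) := by
  have hκ := h.nonneg
  have h1 := h.dist_proj_zpow_smul m (h.dist_proj_smul_zpow_smul_le hn (e := -m)
    (x := g⁻¹ • o) (by rw [len_zpow_neg]; linarith) (by linarith [hg.dist_inv_le]))
  have h2 : g⁻¹ • (g * (c ^ m * n * c ^ (-m)) * g⁻¹) • o = c ^ m • n • c ^ (-m) • g⁻¹ • o := by
    simp only [smul_smul]
    congr 1
    group
  rw [← h2] at h1
  have h3 := h.len_add_len_add_dist_le hm (by linarith [hg.dist_inv_le])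
    (h1.trans (by linarith))
  rw [dist_smul_smul_eq_len, ← len] at h3
  have h4 : (g * c ^ m)⁻¹ * (g * (c ^ m * n * c ^ (-m)) * g⁻¹) = n * (c ^ (-m) * g⁻¹) := by
    group
  rw [h4] at h3
  have h5 : len o g ≤ len o n + len o (n * (c ^ (-m) * g⁻¹)) + len o (c ^ m) := by
    have e1 := len_mul_le o (c ^ m) (c ^ (-m) * g⁻¹)
    have e2 := len_mul_le o n⁻¹ (n * (c ^ (-m) * g⁻¹))
    rw [inv_mul_cancel_left, len_inv] at e2
    rw [← mul_assoc, ← zpow_add, add_neg_cancel, zpow_zero, one_mul, len_inv] at e1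
    linarith
  linarith

end AxisSystem

end Cogrowth

/-! ### Positive density of admissible elements -/

namespace Cogrowth

variable {G X : Type*} [Group G] [MetricSpace X] [MulAction G X] [IsIsometricSMul G X]
  {o : X} {c : G} {τ : X → X} {κ : ℝ}

namespace AxisSystem

variable {K : ℝ} {g n : G} {m : ℤ} {δ Δ M : ℝ}

/-- Multiplying a group element on both sides by one of `1`, `n`, `n⁻¹`, where `n` is transverse
to the axis, one obtains an element which moves the base point away from the axis. -/
theorem exists_mul_mul_dist_proj_le (h : AxisSystem o c τ κ) (hn : n ∉ elementaryClosure c)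
    {k : ℝ} (hk : dist (τ (n • o)) o ≤ k) (hk' : dist (τ (n⁻¹ • o)) o ≤ k) (g : G) :
    ∃ a b, (a = 1 ∨ a = n) ∧ (b = 1 ∨ b = n) ∧
      dist (τ ((a⁻¹ * g * b) • o)) o ≤ 3 * κ + k + len o n ∧
      dist (τ ((a⁻¹ * g * b)⁻¹ • o)) o ≤ 3 * κ + k + len o n := by
  have hκ := h.nonneg
  have hl := len_nonneg o n
  -- If y⁻¹ o projects near n o, it already projects near o. Otherwise transversality along n
  -- controls the projection of n⁻¹ y⁻¹ o.
  have key : ∀ y : G, ∃ f, (f = 1 ∨ f = n) ∧ dist (τ ((y * f)⁻¹ • o)) o ≤ 2 * κ + k := by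
    intro y
    rcases le_or_gt (dist (τ (y⁻¹ • o)) (τ (n • o))) (2 * κ) with hc | hc
    · refine ⟨1, Or.inl rfl, ?_⟩
      rw [mul_one]
      linarith [dist_triangle (τ (y⁻¹ • o)) (τ (n • o)) o]
    · refine ⟨n, Or.inr rfl, ?_⟩
      have := h.transverse hn hc
      rw [smul_smul, ← mul_inv_rev] at this
      linarith [dist_triangle (τ ((y * n)⁻¹ • o)) (τ (n⁻¹ • o)) o]
  obtain ⟨b, hb, hgb⟩ := key g
  obtain ⟨a, ha, hga⟩ := key (g * b)⁻¹
  refine ⟨a, b, ha, hb, ?_, ?_⟩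
  · rw [mul_inv_rev, inv_inv, ← mul_assoc] at hga
    linarith
  · have hla : len o a ≤ len o n := by
      rcases ha with rfl | rfl
      · rwa [len_one]
      · exact le_rfl
    -- The correction by a on the left disturbs the earlier one by at most |n| + κ.
    have e1 := h.lipschitz ((a⁻¹ * g * b)⁻¹ • o) ((g * b)⁻¹ • o)
    have e2 : (a⁻¹ * g * b)⁻¹ = (g * b)⁻¹ * a := by group
    rw [e2, mul_smul, dist_smul, dist_comm (a • o), ← len, ← mul_smul] at e1
    rw [e2]
    linarith [dist_triangle (τ (((g * b)⁻¹ * a) • o)) (τ ((g * b)⁻¹ • o)) o]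

/-- Admissible elements, even when restricted to distinct cosets of the elementary closure, have
a positive proportion in all large shells. -/
theorem exists_admissible_density (h : AxisSystem o c τ κ) (hG : HasShellGrowth G o δ Δ M)
    (hn : n ∉ elementaryClosure c) : ∃ K η Δ' ρ₀ : ℝ, IsAdmissible o c τ K n ∧ 0 < η ∧ 0 < Δ' ∧
      ∀ ρ, ρ₀ ≤ ρ → ∃ S : Finset G,
        (∀ g ∈ S, IsAdmissible o c τ K g ∧ ρ ≤ len o g ∧ len o g < ρ + Δ') ∧
        (∀ g ∈ S, ∀ g' ∈ S, g ≠ g' → g⁻¹ * g' ∉ elementaryClosure c) ∧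
        η * Real.exp (δ * ρ) ≤ S.card := by
  classical
  have hκ := h.nonneg
  have hln := len_nonneg o n
  have hM := hG.const_pos
  set k := max (dist (τ (n • o)) o) (dist (τ (n⁻¹ • o)) o) with hk
  have hk1 : dist (τ (n • o)) o ≤ k := le_max_left _ _
  have hk2 : dist (τ (n⁻¹ • o)) o ≤ k := le_max_right _ _
  set K := 3 * κ + k + len o n with hK
  set Δ' := Δ + 4 * len o n with hΔ'
  obtain ⟨a, b, -, hab⟩ := h.exists_linear_bound
  set F := (h.finite_len_le (2 * K + 3 * κ)).toFinset with hF
  have hK0 : 0 ≤ K := by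
    have := dist_nonneg.trans hk1
    positivity
  have hFpos : 0 < F.card := by
    refine Finset.card_pos.2 ⟨1, ?_⟩
    rw [hF, Set.Finite.mem_toFinset, Set.mem_ofPred_eq, len_one]
    positivity
  have hFpos' : (0 : ℝ) < F.card := by exact_mod_cast hFpos
  have h8M : 0 < 8 * M := by positivity
  have hev := (eventually_linear_le_exp a (a * Δ' + b) hG.rate_pos
    (inv_pos.2 h8M)).and (eventually_ge_atTop 0)
  obtain ⟨ρ₀, hρ₀⟩ := eventually_atTop.1 hev
  refine ⟨K, 1 / (8 * M * F.card), Δ', ρ₀, ⟨hn, by linarith, by linarith⟩,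
    one_div_pos.2 (mul_pos h8M hFpos'),
    by have := hG.width_pos; positivity, fun ρ hρ => ?_⟩
  obtain ⟨hlin, hρ0⟩ := hρ₀ ρ hρ
  have hfin : ∀ r s, {g : G | r ≤ len o g ∧ len o g < s}.Finite := fun r s =>
    (h.finite_len_le s).subset fun g hg => hg.2.le
  -- Two factors of length at most |n| change lengths by at most 2|n|; the shift keeps the corrected
  -- elements in the shell of width Δ' above ρ.
  set r := ρ + 2 * len o n with hr
  set S0 := (hfin r (r + Δ)).toFinset with hS0
  set T := (hfin ρ (ρ + Δ')).toFinset.filter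
    (fun g => dist (τ (g • o)) o ≤ K ∧ dist (τ (g⁻¹ • o)) o ≤ K) with hT
  have hST : S0.card ≤ 4 * T.card := by
    set P : Finset (G × G) := ({1, n} : Finset G) ×ˢ ({1, n} : Finset G)
    have hsub : S0 ⊆ Finset.image₂ (fun (p : G × G) t => p.1 * t * p.2⁻¹) P T := by
      intro g hg
      rw [hS0, Set.Finite.mem_toFinset] at hg
      obtain ⟨hg1, hg2⟩ := hg
      obtain ⟨a, b, ha, hb, h1, h2⟩ := h.exists_mul_mul_dist_proj_le hn hk1 hk2 g
      have hlen : ∀ f, (f = 1 ∨ f = n) → len o f ≤ len o n := by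
        rintro f (rfl | rfl)
        · rwa [len_one]
        · exact le_rfl
      have hla := hlen a ha
      have hlb := hlen b hb
      have e1 := len_mul_le o (a⁻¹ * g) b
      have e2 := len_mul_le o a⁻¹ g
      have e3 := len_mul_le o (a * (a⁻¹ * g * b)) b⁻¹
      have e4 := len_mul_le o a (a⁻¹ * g * b)
      have e5 : a * (a⁻¹ * g * b) * b⁻¹ = g := by group
      rw [e5] at e3
      rw [len_inv] at e2 e3
      refine Finset.mem_image₂.2 ⟨(a, b), ?_, a⁻¹ * g * b, ?_, e5⟩
      · simp only [P, Finset.mem_product, Finset.mem_insert, Finset.mem_singleton]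
        exact ⟨ha, hb⟩
      · rw [hT, Finset.mem_filter, Set.Finite.mem_toFinset]
        exact ⟨⟨by linarith, by linarith⟩, h1, h2⟩
    refine (Finset.card_le_card hsub).trans ((Finset.card_image₂_le _ _ _).trans ?_)
    have : P.card ≤ 2 * 2 := by
      rw [Finset.card_product]
      exact Nat.mul_le_mul Finset.card_le_two Finset.card_le_two
    gcongr
  set U := T.filter (fun g => g ∉ elementaryClosure c) with hU
  have hmemU : ∀ g ∈ U, IsAdmissible o c τ K g ∧ ρ ≤ len o g ∧ len o g < ρ + Δ' := by
    intro g hg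
    obtain ⟨hgT, hgE⟩ := Finset.mem_filter.1 hg
    obtain ⟨hgs, h1, h2⟩ := Finset.mem_filter.1 hgT
    rw [Set.Finite.mem_toFinset] at hgs
    exact ⟨⟨hgE, h1, h2⟩, hgs⟩
  have hTU : (T.card : ℝ) ≤ U.card + (a * ρ + (a * Δ' + b)) := by
    have h1 : (T.filter (fun g => g ∈ elementaryClosure c)).card ≤
        {g | g ∈ elementaryClosure c ∧ len o g ≤ ρ + Δ'}.ncard := by
      rw [← Set.ncard_coe_finset]
      refine Set.ncard_le_ncard (fun g hg => ?_)
        ((h.finite_len_le (ρ + Δ')).subset fun g hg => hg.2)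
      obtain ⟨hgT, hgE⟩ := Finset.mem_filter.1 (Finset.mem_coe.1 hg)
      exact ⟨hgE, ((Set.Finite.mem_toFinset _).1 (Finset.mem_filter.1 hgT).1).2.le⟩
    have h2 := hab (ρ + Δ') (by have := hG.width_pos; positivity)
    have h3 := Finset.card_filter_add_card_filter_not (s := T)
      (fun g => g ∈ elementaryClosure c)
    have h4 : (T.card : ℝ) =
        (T.filter (fun g => g ∈ elementaryClosure c)).card + U.card := by exact_mod_cast h3.symm
    have h5 : ((T.filter (fun g => g ∈ elementaryClosure c)).card : ℝ) ≤
      {g | g ∈ elementaryClosure c ∧ len o g ≤ ρ + Δ'}.ncard := by exact_mod_cast h1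
    linarith
  have hS0card : Real.exp (δ * ρ) / M ≤ S0.card := by
    have h1 := hG.lower r (by positivity)
    rw [Set.ncard_eq_toFinset_card _ (hfin r (r + Δ))] at h1
    refine le_trans ?_ h1
    have := hG.rate_pos
    gcongr
    linarith
  have hUcard : Real.exp (δ * ρ) / (8 * M) ≤ U.card := by
    have h1 : (S0.card : ℝ) ≤ 4 * T.card := by exact_mod_cast hST
    have h2 : Real.exp (δ * ρ) / M = 8 * ((8 * M)⁻¹ * Real.exp (δ * ρ)) := by
      rw [mul_inv, div_eq_inv_mul]
      ring
    rw [div_eq_inv_mul]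
    linarith
  -- One representative per coset. The correction costs a factor 4, removing the linearly many
  -- elements of the commensurator a factor 2, and passing to cosets a factor |F|, which gives η.
  obtain ⟨S, hSU, hinj, himg⟩ := Finset.exists_subset_injOn_image_eq_of_surjOn (U : Set G)
    (U.image (QuotientGroup.mk (s := elementaryClosure c))) (by
      rw [Finset.coe_image]
      exact Set.surjOn_image _ _)
  refine ⟨S, fun g hg => hmemU g (hSU hg), fun g hg g' hg' hne hE => ?_, ?_⟩
  · exact hne (hinj hg hg' (QuotientGroup.eq.2 hE))
  · have hUS : U ⊆ Finset.image₂ (fun s f => s * f) S F := by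
      intro g hg
      have : (QuotientGroup.mk g : G ⧸ elementaryClosure c) ∈ S.image QuotientGroup.mk := by
        rw [himg]
        exact Finset.mem_image_of_mem _ hg
      obtain ⟨s, hs, hsg⟩ := Finset.mem_image.1 this
      refine Finset.mem_image₂.2 ⟨s, hs, s⁻¹ * g, ?_, by group⟩
      rw [hF, Set.Finite.mem_toFinset]
      refine h.len_le_of_mem_elementaryClosure (QuotientGroup.eq.1 hsg) (x := s⁻¹ • o)
        (hmemU s (hSU hs)).1.dist_inv_le ?_
      rw [smul_smul, mul_inv_rev, inv_inv, mul_inv_cancel_right]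
      exact (hmemU g hg).1.dist_inv_le
    have h1 : (U.card : ℝ) ≤ S.card * F.card := by
      exact_mod_cast (Finset.card_le_card hUS).trans (Finset.card_image₂_le _ _ _)
    rw [one_div_mul_eq_div, div_le_iff₀ (mul_pos h8M hFpos')]
    rw [div_le_iff₀ h8M] at hUcard
    calc _ ≤ _ := hUcard
      _ ≤ S.card * F.card * (8 * M) := mul_le_mul_of_nonneg_right h1 h8M.le
      _ = _ := by ring

end AxisSystem

end Cogrowth

/-! ### Discarding shadows and building a free set of words -/

namespace Cogrowth

variable {G X : Type*} [Group G] [MetricSpace X] [MulAction G X] [IsIsometricSMul G X]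
  {o : X} {c : G} {τ : X → X} {κ : ℝ} {δ Δ M : ℝ}

omit [IsIsometricSMul G X] in
/-- The number of elements of bounded length in a shadow. -/
theorem HasShellGrowth.ncard_inShadow_le (hG : HasShellGrowth G o δ Δ M)
    (hproper : IsProperAction G o) (s t : ℝ) (f a : G) (S : Finset G)
    (hS : ∀ g ∈ S, InShadow o s f a g ∧ len o g ≤ t) :
    (S.card : ℝ) ≤ M * Real.exp (δ * (t + s - len o a)) := by
  refine le_trans ?_ (hG.upper (t + s - len o a))
  rw [← Set.ncard_coe_finset]
  refine Nat.cast_le.2 (Set.ncard_le_ncard_of_injOn (fun g => (a * f)⁻¹ * g) (fun g hg => ?_)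
    (mul_right_injective _).injOn (hproper o _))
  obtain ⟨h1, h2⟩ := hS g hg
  rw [InShadow] at h1
  rw [Set.mem_ofPred_eq]
  linarith [len_nonneg o f]

omit [IsIsometricSMul G X] in
/-- From sets of points in sparse shells one can remove those lying in the shadows of previous
ones, while keeping a definite proportion of each. -/
theorem HasShellGrowth.card_le_two_mul_card_filter (hG : HasShellGrowth G o δ Δ M)
    (hproper : IsProperAction G o) {η Δ' s b R : ℝ} (f : G) (a : G → G)
    (q : ℕ) (r : ℕ → ℝ) (hr : ∀ i, R ≤ r i) (S : ℕ → Finset G)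
    (hS : ∀ i, ∀ g ∈ S i, r i ≤ len o g ∧ len o g < r i + Δ')
    (hcard : ∀ i, η * Real.exp (δ * r i) ≤ (S i).card)
    (ha : ∀ i, ∀ g ∈ S i, 2 * len o g ≤ len o (a g) + b)
    (hq : q * (M * M * Real.exp (δ * (2 * Δ' + s + b - R))) ≤ η / 2)
    {i : ℕ} (hi : i < q) [DecidablePred fun g' => ∃ j < i, ∃ g ∈ S j, InShadow o s f (a g) g'] :
    η / 2 * Real.exp (δ * r i) ≤
      ((S i).filter fun g' => ¬ ∃ j < i, ∃ g ∈ S j, InShadow o s f (a g) g').card := by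
  classical
  have hM := hG.const_pos
  have hδ := hG.rate_pos
  set B := (S i).filter fun g' => ∃ j < i, ∃ g ∈ S j, InShadow o s f (a g) g' with hB
  have hsub : B ⊆ (Finset.range i).biUnion fun j => (S j).biUnion fun g =>
      (S i).filter fun g' => InShadow o s f (a g) g' := by
    intro g' hg'
    obtain ⟨hg'S, j, hj, g, hg, hsh⟩ := Finset.mem_filter.1 hg'
    simp only [Finset.mem_biUnion, Finset.mem_range, Finset.mem_filter]
    exact ⟨j, hj, g, hg, hg'S, hsh⟩
  have hSj : ∀ j, ((S j).card : ℝ) ≤ M * Real.exp (δ * (r j + Δ')) := by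
    intro j
    refine le_trans ?_ (hG.upper (r j + Δ'))
    rw [← Set.ncard_coe_finset]
    exact Nat.cast_le.2 (Set.ncard_le_ncard (fun g hg => (hS j g hg).2.le) (hproper o _))
  have hone : ∀ j, ∀ g ∈ S j, (((S i).filter fun g' => InShadow o s f (a g) g').card : ℝ) ≤
      M * Real.exp (δ * (r i + Δ' + s + b - 2 * r j)) := by
    intro j g hg
    refine (hG.ncard_inShadow_le hproper s (r i + Δ') f (a g) _ fun g' hg' => ?_).trans ?_
    · obtain ⟨h1, h2⟩ := Finset.mem_filter.1 hg'
      exact ⟨h2, (hS i g' h1).2.le⟩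
    · have h1 := ha j g hg
      have h2 := (hS j g hg).1
      refine mul_le_mul_of_nonneg_left (Real.exp_le_exp.2
        (mul_le_mul_of_nonneg_left ?_ hδ.le)) hM.le
      linarith
  have hBcard : (B.card : ℝ) ≤ η / 2 * Real.exp (δ * r i) := by
    have h1 : B.card ≤ ∑ j ∈ Finset.range i, ∑ g ∈ S j,
        ((S i).filter fun g' => InShadow o s f (a g) g').card :=
      (Finset.card_le_card hsub).trans (Finset.card_biUnion_le.trans
        (Finset.sum_le_sum fun j _ => Finset.card_biUnion_le))
    -- Shell j casts O(exp(δ r_j)) shadows, each with O(exp(δ(r_i - 2 r_j))) elements of shell i.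
    -- The total is a proportion O(exp(-δ r_j)) ≤ O(exp(-δR)) of exp(δ r_i).
    calc (B.card : ℝ) ≤ ∑ j ∈ Finset.range i, ∑ g ∈ S j,
        (((S i).filter fun g' => InShadow o s f (a g) g').card : ℝ) := by exact_mod_cast h1
      _ ≤ ∑ j ∈ Finset.range i, ∑ g ∈ S j, M * Real.exp (δ * (r i + Δ' + s + b - 2 * r j)) :=
        Finset.sum_le_sum fun j _ => Finset.sum_le_sum fun g hg => hone j g hg
      _ = ∑ j ∈ Finset.range i, (S j).card * (M * Real.exp (δ * (r i + Δ' + s + b - 2 * r j))) := by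
        simp only [Finset.sum_const, nsmul_eq_mul]
      _ ≤ ∑ j ∈ Finset.range i,
          M * M * Real.exp (δ * (2 * Δ' + s + b - R)) * Real.exp (δ * r i) := by
        refine Finset.sum_le_sum fun j _ => ?_
        calc _ ≤ M * Real.exp (δ * (r j + Δ')) *
              (M * Real.exp (δ * (r i + Δ' + s + b - 2 * r j))) :=
            mul_le_mul_of_nonneg_right (hSj j) (by positivity)
          _ = M * M * Real.exp (δ * (r j + Δ') + δ * (r i + Δ' + s + b - 2 * r j)) := by
            rw [Real.exp_add]
            ring
          _ ≤ M * M * Real.exp (δ * (2 * Δ' + s + b - R) + δ * r i) := by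
            have := hr j
            rw [← mul_add, ← mul_add]
            refine mul_le_mul_of_nonneg_left (Real.exp_le_exp.2
              (mul_le_mul_of_nonneg_left ?_ hδ.le)) (by positivity)
            linarith
          _ = _ := by
            rw [Real.exp_add]
            ring
      _ = i * (M * M * Real.exp (δ * (2 * Δ' + s + b - R))) * Real.exp (δ * r i) := by
        rw [Finset.sum_const, Finset.card_range, nsmul_eq_mul]
        ring
      _ ≤ q * (M * M * Real.exp (δ * (2 * Δ' + s + b - R))) * Real.exp (δ * r i) := by
        have : (i : ℝ) ≤ q := by exact_mod_cast hi.le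
        gcongr
      _ ≤ _ := by gcongr
  have h1 := Finset.card_filter_add_card_filter_not (s := S i)
    (fun g' => ∃ j < i, ∃ g ∈ S j, InShadow o s f (a g) g')
  have h2 : ((S i).card : ℝ) = B.card + ((S i).filter fun g' =>
      ¬ ∃ j < i, ∃ g ∈ S j, InShadow o s f (a g) g').card := by exact_mod_cast h1.symm
  linarith [hcard i]

/-- Existence of a large free set of words: the elements `conjWord u g` with `g ∈ A` play
ping-pong on `Q`, and the Poincaré series of `A` is large. -/
theorem AxisSystem.exists_free_words (h : AxisSystem o c τ κ) (hG : HasShellGrowth G o δ Δ M)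
    {n : G} (hn : n ∉ elementaryClosure c) : ∃ (m : ℤ) (A : Finset G) (Q : Set X), o ∈ Q ∧
      (∀ g ∈ A, ∀ x ∈ Q, conjWord (c ^ m * n * c ^ (-m)) g • x ∈ Q) ∧
      (∀ g ∈ A, ∀ g' ∈ A, g ≠ g' → ∀ x ∈ Q, ∀ x' ∈ Q,
        conjWord (c ^ m * n * c ^ (-m)) g • x ≠ conjWord (c ^ m * n * c ^ (-m)) g' • x') ∧
      1 < ∑ g ∈ A, Real.exp (-(δ * (len o g + len o (c ^ m * n * c ^ (-m))))) := by
  classical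
  have hκ := h.nonneg
  have hδ := hG.rate_pos
  have hM := hG.const_pos
  obtain ⟨K, η, Δ', ρ₀, hnK, hη, hΔ', hdens⟩ := h.exists_admissible_density hG hn
  have hK : 0 ≤ K := dist_nonneg.trans hnK.dist_le
  set s := 4 * K + 17 * κ with hs
  obtain ⟨m', -, hm'⟩ := h.exists_len_zpow_mul_gt one_ne_zero (s + Δ')
  rw [one_mul] at hm'
  set m : ℤ := (m' : ℤ)
  set u := c ^ m * n * c ^ (-m) with hu
  have hm1 : 2 * K + 9 * κ < len o (c ^ m) := by linarith
  -- Guaranteed contribution of one shell to the final sum. It does not depend on the radius, so the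
  -- number q of shells can be fixed before R.
  set σ := η / 2 * Real.exp (-(δ * (Δ' + len o u))) with hσ
  have hσ0 : 0 < σ := by positivity
  obtain ⟨q, hq⟩ := exists_nat_gt (1 / σ)
  rw [div_lt_iff₀ hσ0] at hq
  set b := len o n + s with hb
  have hlim : Tendsto (fun R : ℝ => q * (M * M * Real.exp (δ * (2 * Δ' + s + b - R)))) atTop
      (nhds 0) := by
    have h1 : Tendsto (fun R : ℝ => δ * (2 * Δ' + s + b - R)) atTop atBot :=
      (tendsto_atBot_add_const_left _ _ tendsto_neg_atTop_atBot).const_mul_atBot hδ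
    simpa using ((Real.tendsto_exp_atBot.comp h1).const_mul (M * M)).const_mul (q : ℝ)
  obtain ⟨R, ⟨⟨hR1, hR2⟩, hR3⟩, hR4⟩ := (((hlim.eventually (eventually_le_nhds
    (by positivity : (0 : ℝ) < η / 2))).and (eventually_ge_atTop ρ₀)).and
    (eventually_ge_atTop 0)).and (eventually_gt_atTop (2 * Δ' + len o u + s)) |>.exists
  -- The ratio 3 makes later elements longer than twice the earlier ones, with an excess of at least
  -- R to absorb the constants.
  set r : ℕ → ℝ := fun i => R * 3 ^ i with hr
  have hrR : ∀ i, R ≤ r i := fun i => le_mul_of_one_le_right hR3 (one_le_pow₀ (by norm_num))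
  have hr3 : ∀ {i j : ℕ}, i < j → 3 * r i ≤ r j := by
    intro i j hij
    calc 3 * r i = R * 3 ^ (i + 1) := by simp only [hr]; ring
      _ ≤ R * 3 ^ j := by gcongr <;> [norm_num; omega]
  choose S hS1 hS2 hS3 using fun i => hdens (r i) (hR2.trans (hrR i))
  set a : G → G := fun g => g * u * g⁻¹
  set A : ℕ → Finset G := fun i => (S i).filter
    (fun g' => ¬ ∃ j < i, ∃ g ∈ S j, InShadow o s (c ^ m) (a g) g') with hA
  have hAS : ∀ {i g}, g ∈ A i → g ∈ S i := fun hg => (Finset.mem_filter.1 hg).1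
  have hAcard : ∀ i < q, η / 2 * Real.exp (δ * r i) ≤ (A i).card := fun i hi =>
    hG.card_le_two_mul_card_filter h.proper (c ^ m) a q r hrR S
      (fun i g hg => (hS1 i g hg).2) hS3
      (fun i g hg => by
        have := h.two_mul_len_le_len_conj hnK hm1 (hS1 i g hg).1
        linarith) hR1 hi
  have hlu := len_nonneg o u
  have hgap : ∀ {i j : ℕ}, i < j → ∀ {g g'}, g ∈ A i → g' ∈ A j →
      2 * len o g + len o u + s < len o g' := by
    intro i j hij g g' hg hg'
    linarith [(hS1 i g (hAS hg)).2.2, (hS1 j g' (hAS hg')).2.1, hr3 hij, hrR i]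
  have hlt : ∀ {i j : ℕ}, i < j → ∀ {g g'}, g ∈ A i → g' ∈ A j → ∀ x, dist (τ x) o ≤ K + 2 * κ →
      ∀ x', dist (τ x') o ≤ K + 2 * κ → conjWord u g • x ≠ conjWord u g' • x' := by
    intro i j hij g g' hg hg' x hx x' hx'
    exact h.conjWord_smul_ne_of_not_inShadow hnK hm1 (hS1 i g (hAS hg)).1
      (hS1 j g' (hAS hg')).1 (hgap hij hg hg')
      (fun hsh => (Finset.mem_filter.1 hg').2 ⟨i, hij, g, hAS hg, hsh⟩) hx hx'
  refine ⟨m, (Finset.range q).biUnion A, {x | dist (τ x) o ≤ K + 2 * κ}, ?_, ?_, ?_, ?_⟩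
  · rw [Set.mem_ofPred_eq, h.apply_base, dist_self]
    positivity
  · intro g hg x hx
    obtain ⟨i, -, hg⟩ := Finset.mem_biUnion.1 hg
    exact h.dist_proj_conjWord_smul_le hnK (by linarith) (hS1 i g (hAS hg)).1 hx
  · intro g hg g' hg' hne x hx x' hx'
    obtain ⟨i, -, hg⟩ := Finset.mem_biUnion.1 hg
    obtain ⟨j, -, hg'⟩ := Finset.mem_biUnion.1 hg'
    rcases lt_trichotomy i j with hij | rfl | hij
    · exact hlt hij hg hg' x hx x' hx'
    · obtain ⟨ga, g1, g2⟩ := hS1 i g (hAS hg)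
      obtain ⟨ga', g1', g2'⟩ := hS1 i g' (hAS hg')
      exact h.conjWord_smul_ne_of_not_mem hnK (Δ := Δ') (by linarith) hm1 ga ga'
        (hS2 i g (hAS hg) g' (hAS hg') hne) (abs_lt.2 ⟨by linarith, by linarith⟩) hx hx'
    · exact (hlt hij hg' hg x' hx' x hx).symm
  · have hdisj : Set.PairwiseDisjoint (Finset.range q : Set ℕ) A := by
      intro i _ j _ hij
      rw [Function.onFun, Finset.disjoint_left]
      intro g hg hg'
      have := len_nonneg o g
      rcases lt_or_gt_of_ne hij with hlt' | hlt'
      · linarith [hgap hlt' hg hg']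
      · linarith [hgap hlt' hg' hg]
    rw [Finset.sum_biUnion hdisj]
    calc 1 < q * σ := hq
      _ = ∑ i ∈ Finset.range q, σ := by rw [Finset.sum_const, Finset.card_range, nsmul_eq_mul]
      _ ≤ _ := Finset.sum_le_sum fun i hi => ?_
    calc σ = η / 2 * Real.exp (δ * r i) * Real.exp (-(δ * (r i + Δ' + len o u))) := by
          rw [hσ, mul_assoc, ← Real.exp_add]
          congr 2
          ring
      _ ≤ (A i).card * Real.exp (-(δ * (r i + Δ' + len o u))) := by
        gcongr
        exact hAcard i (Finset.mem_range.1 hi)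
      _ = ∑ g ∈ A i, Real.exp (-(δ * (r i + Δ' + len o u))) := by
        rw [Finset.sum_const, nsmul_eq_mul]
      _ ≤ _ := by
        refine Finset.sum_le_sum fun g hg => ?_
        have := (hS1 i g (hAS hg)).2.2
        gcongr

end Cogrowth

/-! ### Growth rates and Poincaré series -/

namespace Cogrowth

section Growth

variable {X : Type*} [MetricSpace X] {o : X} {Y Z : Set X}

theorem growthRate_mono (hne : o ∈ Y) (hYZ : Y ⊆ Z)
    (hfin : ∀ r, (Z ∩ Metric.closedBall o r).Finite) : growthRate o Y ≤ growthRate o Z := by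
  refine limsup_le_limsup ?_
  filter_upwards [eventually_ge_atTop 0] with r hr
  have hsub : Y ∩ Metric.closedBall o r ⊆ Z ∩ Metric.closedBall o r :=
    Set.inter_subset_inter_left _ hYZ
  have hpos : 0 < (Y ∩ Metric.closedBall o r).ncard :=
    (Set.ncard_pos ((hfin r).subset hsub)).2 ⟨o, hne, Metric.mem_closedBall_self hr⟩
  have hle : (Y ∩ Metric.closedBall o r).ncard ≤ (Z ∩ Metric.closedBall o r).ncard :=
    Set.ncard_le_ncard hsub (hfin r)
  refine EReal.coe_le_coe_iff.2 (div_le_div_of_nonneg_right ?_ hr)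
  exact Real.log_le_log (by exact_mod_cast hpos) (by exact_mod_cast hle)

theorem growthRate_le_of_ncard_le {δ M : ℝ} (hM : 0 < M) (hne : o ∈ Y)
    (hfin : ∀ r, (Y ∩ Metric.closedBall o r).Finite)
    (h : ∀ r, ((Y ∩ Metric.closedBall o r).ncard : ℝ) ≤ M * Real.exp (δ * r)) :
    growthRate o Y ≤ (δ : EReal) := by
  have hlim : Tendsto (fun r : ℝ => ((Real.log M / r + δ : ℝ) : EReal)) atTop
      (nhds (δ : EReal)) := by
    refine (continuous_coe_real_ereal.tendsto δ).comp ?_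
    simpa using (tendsto_const_nhds (x := Real.log M)).div_atTop tendsto_id |>.add_const δ
  rw [← hlim.limsup_eq]
  refine limsup_le_limsup ?_
  filter_upwards [eventually_gt_atTop 0] with r hr
  have hpos : 0 < (Y ∩ Metric.closedBall o r).ncard :=
    (Set.ncard_pos (hfin r)).2 ⟨o, hne, Metric.mem_closedBall_self hr.le⟩
  have h1 := Real.log_le_log (by exact_mod_cast hpos) (h r)
  rw [Real.log_mul hM.ne' (Real.exp_ne_zero _), Real.log_exp] at h1
  refine EReal.coe_le_coe_iff.2 ?_
  rw [div_le_iff₀ hr, add_mul, div_mul_cancel₀ _ hr.ne']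
  exact h1

theorem exists_ncard_le_of_growthRate_lt {s : ℝ} (hs : 0 ≤ s)
    (hfin : ∀ r, (Y ∩ Metric.closedBall o r).Finite) (h : growthRate o Y < (s : EReal)) :
    ∃ D : ℝ, 0 ≤ D ∧ ∀ r, 0 ≤ r →
      ((Y ∩ Metric.closedBall o r).ncard : ℝ) ≤ D * Real.exp (s * r) := by
  obtain ⟨r₀, hr₀⟩ := eventually_atTop.1 ((eventually_lt_of_limsup_lt h).and
    (eventually_gt_atTop 0))
  have hbig : ∀ r, r₀ ≤ r → ((Y ∩ Metric.closedBall o r).ncard : ℝ) ≤ Real.exp (s * r) := by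
    intro r hr
    obtain ⟨h1, h2⟩ := hr₀ r hr
    rw [EReal.coe_lt_coe_iff, div_lt_iff₀ h2] at h1
    rcases Nat.eq_zero_or_pos (Y ∩ Metric.closedBall o r).ncard with h0 | h0
    · rw [h0, Nat.cast_zero]
      positivity
    · exact (Real.log_le_iff_le_exp (by exact_mod_cast h0)).1 h1.le
  refine ⟨(Y ∩ Metric.closedBall o r₀).ncard + 1, by positivity, fun r hr => ?_⟩
  have hexp : 1 ≤ Real.exp (s * r) := Real.one_le_exp (by positivity)
  rcases le_total r₀ r with hr' | hr'
  · refine (hbig r hr').trans (le_mul_of_one_le_left (by positivity) ?_)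
    linarith [Nat.cast_nonneg (α := ℝ) (Y ∩ Metric.closedBall o r₀).ncard]
  · have h1 : (Y ∩ Metric.closedBall o r).ncard ≤ (Y ∩ Metric.closedBall o r₀).ncard :=
      Set.ncard_le_ncard (Set.inter_subset_inter_right _ (Metric.closedBall_subset_closedBall hr'))
        (hfin r₀)
    have h2 : ((Y ∩ Metric.closedBall o r).ncard : ℝ) ≤ (Y ∩ Metric.closedBall o r₀).ncard := by
      exact_mod_cast h1
    refine le_trans ?_ (le_mul_of_one_le_right (by positivity) hexp)
    linarith

/-- The Poincaré series of a set converges at exponents larger than its growth rate. -/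
theorem exists_sum_exp_le_of_growthRate_lt {s t : ℝ} (hs : 0 ≤ s) (hst : s < t)
    (hfin : ∀ r, (Y ∩ Metric.closedBall o r).Finite) (h : growthRate o Y < (s : EReal)) :
    ∃ B : ℝ, ∀ T : Finset X, (T : Set X) ⊆ Y → ∑ p ∈ T, Real.exp (-(t * dist o p)) ≤ B := by
  classical
  obtain ⟨D, hD, hY⟩ := exists_ncard_le_of_growthRate_lt hs hfin h
  set x := Real.exp (s - t) with hx
  have hx1 : x < 1 := by
    rw [hx, ← Real.exp_zero]
    exact Real.exp_lt_exp.2 (by linarith)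
  have hx0 : 0 ≤ x := (Real.exp_pos _).le
  refine ⟨D * Real.exp s * (1 - x)⁻¹, fun T hT => ?_⟩
  set J := T.sup (fun p => ⌊dist o p⌋₊) + 1
  have hmaps : ∀ p ∈ T, ⌊dist o p⌋₊ ∈ Finset.range J := fun p hp =>
    Finset.mem_range.2 (Nat.lt_succ_of_le (Finset.le_sup (f := fun p => ⌊dist o p⌋₊) hp))
  rw [← Finset.sum_fiberwise_of_maps_to hmaps]
  calc _ ≤ ∑ j ∈ Finset.range J, D * Real.exp s * x ^ j := Finset.sum_le_sum fun j _ => ?_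
    _ = D * Real.exp s * ∑ j ∈ Finset.range J, x ^ j := by rw [Finset.mul_sum]
    _ ≤ _ := by
      rw [← tsum_geometric_of_lt_one hx0 hx1]
      gcongr
      exact (summable_geometric_of_lt_one hx0 hx1).sum_le_tsum _ fun i _ => pow_nonneg hx0 i
  have ht : 0 < t := by linarith
  have hcard : ((T.filter fun p => ⌊dist o p⌋₊ = j).card : ℝ) ≤ D * Real.exp (s * (j + 1)) := by
    refine le_trans ?_ (hY (j + 1) (by positivity))
    rw [← Set.ncard_coe_finset]
    refine Nat.cast_le.2 (Set.ncard_le_ncard (fun p hp => ?_) (hfin _))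
    obtain ⟨hpT, hpj⟩ := Finset.mem_filter.1 (Finset.mem_coe.1 hp)
    refine ⟨hT hpT, ?_⟩
    rw [Metric.mem_closedBall, dist_comm, ← hpj]
    exact (Nat.lt_floor_add_one _).le
  calc _ ≤ ∑ p ∈ T.filter (fun p => ⌊dist o p⌋₊ = j), Real.exp (-(t * j)) := by
        refine Finset.sum_le_sum fun p hp => ?_
        have := Nat.floor_le (dist_nonneg (x := o) (y := p))
        rw [(Finset.mem_filter.1 hp).2] at this
        gcongr
    _ = (T.filter fun p => ⌊dist o p⌋₊ = j).card * Real.exp (-(t * j)) := by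
      rw [Finset.sum_const, nsmul_eq_mul]
    _ ≤ D * Real.exp (s * (j + 1)) * Real.exp (-(t * j)) := by gcongr
    _ = _ := by
      rw [hx, ← Real.exp_nat_mul, mul_assoc, mul_assoc, ← Real.exp_add, ← Real.exp_add]
      congr 2
      ring

end Growth

variable {G X : Type*} [Group G] [MetricSpace X] [MulAction G X] [IsIsometricSMul G X] {o : X}

/-- If finitely many elements `w g` of a subgroup play ping-pong freely, then sums over words
of length `k` of the Poincaré series of the orbit are at least the `k`-th power of the sum over
the generators. -/
theorem exists_pow_le_sum_exp {ι : Type*} (N : Subgroup G) {A : Finset ι} {w : ι → G} {Q : Set X}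
    (ho : o ∈ Q) (hwN : ∀ g ∈ A, w g ∈ N) (hQ : ∀ g ∈ A, ∀ x ∈ Q, w g • x ∈ Q)
    (hfree : ∀ g ∈ A, ∀ g' ∈ A, g ≠ g' → ∀ x ∈ Q, ∀ x' ∈ Q, w g • x ≠ w g' • x')
    {s : ℝ} (hs : 0 ≤ s) (k : ℕ) : ∃ T : Finset X, (T : Set X) ⊆ MulAction.orbit N o ∧
      (∑ g ∈ A, Real.exp (-(s * len o (w g)))) ^ k ≤ ∑ p ∈ T, Real.exp (-(s * dist o p)) := by
  classical
  -- Points are kept in Q so that the ping-pong hypotheses apply again after each letter. Disjoint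
  -- images make distinct words give distinct points.
  suffices H : ∃ T : Finset X, (T : Set X) ⊆ MulAction.orbit N o ∩ Q ∧
      (∑ g ∈ A, Real.exp (-(s * len o (w g)))) ^ k ≤ ∑ p ∈ T, Real.exp (-(s * dist o p)) by
    obtain ⟨T, hT, hle⟩ := H
    exact ⟨T, fun p hp => (hT hp).1, hle⟩
  induction k with
  | zero => exact ⟨{o}, by
    rw [Finset.coe_singleton, Set.singleton_subset_iff]
    exact ⟨MulAction.mem_orbit_self o, ho⟩, by simp⟩
  | succ k ih =>
    obtain ⟨T, hT, hle⟩ := ih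
    have hinj : Set.InjOn (fun p : ι × X => w p.1 • p.2) (A ×ˢ T : Finset (ι × X)) := by
      rintro ⟨g, x⟩ hg ⟨g', x'⟩ hg' heq
      rw [Finset.mem_coe, Finset.mem_product] at hg hg'
      obtain rfl : g = g' := by
        by_contra hne
        exact hfree g hg.1 g' hg'.1 hne x (hT hg.2).2 x' (hT hg'.2).2 heq
      exact Prod.ext rfl (MulAction.injective (w g) heq)
    refine ⟨(A ×ˢ T).image fun p => w p.1 • p.2, ?_, ?_⟩
    · intro p hp
      obtain ⟨⟨g, x⟩, hgx, rfl⟩ := Finset.mem_image.1 (Finset.mem_coe.1 hp)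
      obtain ⟨hg, hx⟩ := Finset.mem_product.1 hgx
      obtain ⟨⟨n, rfl⟩, hxQ⟩ := hT hx
      exact ⟨⟨⟨w g, hwN g hg⟩ * n, mul_smul _ _ _⟩, hQ g hg _ hxQ⟩
    · rw [Finset.sum_image hinj, Finset.sum_product, pow_succ']
      calc _ ≤ (∑ g ∈ A, Real.exp (-(s * len o (w g)))) *
            ∑ p ∈ T, Real.exp (-(s * dist o p)) := by gcongr
        _ = ∑ g ∈ A, ∑ p ∈ T, Real.exp (-(s * len o (w g))) * Real.exp (-(s * dist o p)) :=
          Finset.sum_mul_sum _ _ _ _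
        _ ≤ _ := by
          refine Finset.sum_le_sum fun g _ => Finset.sum_le_sum fun p _ => ?_
          rw [← Real.exp_add, ← neg_add, ← mul_add]
          have h1 := dist_triangle o (w g • o) (w g • p)
          rw [dist_smul] at h1
          gcongr
          exact h1

omit [IsIsometricSMul G X] in
theorem orbit_inter_closedBall_subset (o : X) (r : ℝ) :
    MulAction.orbit G o ∩ Metric.closedBall o r ⊆ (fun g : G => g • o) '' {g | len o g ≤ r} := by
  rintro _ ⟨⟨g, rfl⟩, hg⟩
  exact ⟨g, by rwa [Metric.mem_closedBall, dist_comm] at hg, rfl⟩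

end Cogrowth

/-! ### Conclusion -/

open Cogrowth in
theorem theorem1p1 {G X : Type*} [Group G] [MetricSpace X] [MulAction G X]
    [IsIsometricSMul G X] (o : X)
    (hgeo : Cogrowth.IsGeodesicSpace X)
    (hproper : Cogrowth.IsProperAction G o)
    (hcontr : ∃ c : G, Cogrowth.IsStronglyContractingElement o c)
    (hgrowth : Cogrowth.HasPurelyExponentialGrowth o (MulAction.orbit G o))
    (N : Subgroup G) (hnormal : N.Normal) (hinf : Infinite N) :
    ((1 / 2 : ℝ) : EReal) <
      Cogrowth.growthRate o (MulAction.orbit N o) /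
        Cogrowth.growthRate o (MulAction.orbit G o) := by
  obtain ⟨c, hc⟩ := hcontr
  obtain ⟨τ, κ₀, hτ⟩ := exists_axisProjection hgeo hproper hc
  obtain ⟨κ, h⟩ := hτ.exists_axisSystem
  obtain ⟨δ, Δ, M, hG⟩ := exists_hasShellGrowth hproper hgrowth
  have hδ := hG.rate_pos
  obtain ⟨n, hnN, hn⟩ := h.exists_mem_not_mem_elementaryClosure
    (h.exists_not_mem_elementaryClosure hG) N
  obtain ⟨m, A, Q, ho, hQ, hfree, hsum⟩ := h.exists_free_words hG hn
  set u := c ^ m * n * c ^ (-m) with hu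
  have huN : u ∈ N := by
    rw [hu, zpow_neg]
    exact hnormal.conj_mem n hnN _
  have hfin : ∀ r, (MulAction.orbit G o ∩ Metric.closedBall o r).Finite := fun r =>
    ((h.finite_len_le r).image _).subset (orbit_inter_closedBall_subset o r)
  have hNG : MulAction.orbit N o ⊆ MulAction.orbit G o := MulAction.orbit_subgroup_subset N o
  have hfinN : ∀ r, (MulAction.orbit N o ∩ Metric.closedBall o r).Finite := fun r =>
    (hfin r).subset (Set.inter_subset_inter_left _ hNG)
  have hGle : growthRate o (MulAction.orbit G o) ≤ (δ : EReal) := by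
    refine growthRate_le_of_ncard_le hG.const_pos (MulAction.mem_orbit_self o) hfin fun r => ?_
    refine le_trans (Nat.cast_le.2 ?_) (hG.upper r)
    exact (Set.ncard_le_ncard (orbit_inter_closedBall_subset o r)
      ((h.finite_len_le r).image _)).trans (Set.ncard_image_le (h.finite_len_le r))
  have hN : ((δ / 2 : ℝ) : EReal) < growthRate o (MulAction.orbit N o) := by
    by_contra! hle
    -- At s = δ/2 this finite sum is the one already known to exceed 1. Continuity leaves room for s
    -- > δ/2, where the Poincaré series of N would converge if its growth rate were at most δ/2.
    have hcont : Continuous fun s : ℝ => ∑ g ∈ A, Real.exp (-(s * (2 * (len o g + len o u)))) := by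
      fun_prop
    have hev : ∀ᶠ s in nhds (δ / 2),
        1 < ∑ g ∈ A, Real.exp (-(s * (2 * (len o g + len o u)))) := by
      refine hcont.continuousAt.eventually (lt_mem_nhds (lt_of_lt_of_eq hsum ?_))
      refine Finset.sum_congr rfl fun g _ => ?_
      congr 1
      ring
    obtain ⟨s, hs1, hs⟩ := ((hev.filter_mono nhdsWithin_le_nhds).and
      (self_mem_nhdsWithin (s := Set.Ioi (δ / 2)))).exists
    obtain ⟨t, ht1, ht2⟩ := exists_between hs
    obtain ⟨B, hB⟩ := exists_sum_exp_le_of_growthRate_lt (by linarith) ht2 hfinN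
      (lt_of_le_of_lt hle (EReal.coe_lt_coe_iff.2 ht1))
    have hρ : 1 < ∑ g ∈ A, Real.exp (-(s * len o (conjWord u g))) := by
      refine hs1.trans_le (Finset.sum_le_sum fun g _ => ?_)
      have h1 := len_mul_le o (g * u * g⁻¹) u
      have h2 := len_mul_le o (g * u) g⁻¹
      have h3 := len_mul_le o g u
      rw [len_inv] at h2
      have h4 : len o (conjWord u g) ≤ 2 * (len o g + len o u) := by
        rw [conjWord]
        linarith
      have h5 : 0 ≤ s := by linarith
      gcongr
    obtain ⟨k, hk⟩ := pow_unbounded_of_one_lt B hρ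
    obtain ⟨T, hT, hle'⟩ := exists_pow_le_sum_exp N (w := conjWord u) ho
      (fun g _ => mul_mem (hnormal.conj_mem u huN g) huN) hQ hfree (s := s) (by linarith) k
    linarith [hB T hT]
  -- Division in `EReal` needs a positive finite denominator; afterwards only the upper bound δ for
  -- the growth rate of G matters.
  have hpos : (0 : EReal) < growthRate o (MulAction.orbit G o) :=
    lt_of_le_of_lt (by exact_mod_cast (by positivity : (0 : ℝ) ≤ δ / 2))
      (hN.trans_le (growthRate_mono (MulAction.mem_orbit_self o) hNG hfin))
  have htop : growthRate o (MulAction.orbit G o) ≠ ⊤ :=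
    (hGle.trans_lt (EReal.coe_lt_top δ)).ne
  rw [EReal.lt_div_iff hpos htop]
  refine lt_of_le_of_lt ?_ hN
  calc _ ≤ ((1 / 2 : ℝ) : EReal) * (δ : EReal) :=
        mul_le_mul_of_nonneg_left hGle (by exact_mod_cast (by norm_num : (0 : ℝ) ≤ 1 / 2))
    _ = ((δ / 2 : ℝ) : EReal) := by
      rw [← EReal.coe_mul]
      congr 1
      ring
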